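/- **Setting.** Let $\tilde\gamma>0$ and let $\gamma^{(N)}_1,\dots,\gamma^{(N)}_N\in[0,\tilde\gamma]$, $N\ge 1$, be a triangular array of eigenvalues whose empirical measures $\frac1N\sum_{i\le N}\delta_{\gamma^{(N)}_i}$ converge in the 1-Wasserstein metric to a probability measure $\rho$. (These are the eigenvalues of the rotationally invariant coupling matrix of the symmetric spherical model, written in the eigenbasis.) We write $\gamma_i$ for $\gamma_i^{(N)}$. For $z\in\mathbb R\setminus[0,\tilde\gamma]$ let $S_\rho(z)=\int_{[0,\tilde\gamma]}\frac{\rho(d\gamma)}{z-\gamma}$, and let $S_{\max}=\lim_{z\downarrow\tilde\gamma}S_\rho(z)\in(0,+\infty]$, $S_{\min}=\lim_{z\uparrow0}S_\rho(z)\in[-\infty,0)$. Then $S_\rho$ is a bijection from $\mathbb R\setminus[0,\tilde\gamma]$ onto $(S_{\min},S_{\max})\setminus\{0\}$; let $K_\rho$ be its inverse, $R_\rho(x)=K_\rho(x)-1/x$, $T_\rho=(S_{\min}/2,S_{\max}/2)\setminus\{0\}$, and $v(\theta)=R_\rho(2\theta)$ for $\theta\in T_\rho$. Let $G$ be the standard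 normal measure on $\mathbb R^N$. For a Hamiltonian $H:\mathbb R^N\to\mathbb R$, its Gibbs mean at (inverse) temperature $\theta$ is $f\mapsto \int f e^{\theta H}\,dG\big/\int e^{\theta H}\,dG$. Let $\langle\cdot\rangle$ be the Gibbs mean of $$H_N(g)=N\sum_{i\le N}\gamma_i\frac{g_i^2}{\|g\|^2},$$ and, for $d\le N$, let $\langle\cdot\rangle_d$ be the Gibbs mean of $$H_d(g)=N\sum_{i\le N,\,i\ne d}\gamma_i\frac{g_i^2}{\|\bar g\|^2}-(v(\theta)-\gamma_d)\,g_d^2,$$ where $\bar g\in\mathbb R^{N-1}$ is $g$ without its $d$-th coordinate (for $N=1$ the sum is empty). Put $h_N=H_N/N$ and $a_N(\theta)=\langle(h_N-v(\theta))^2\rangle$. **Theorem (Decoupling in the high-temperature phase).** Let $\theta\in T_\rho$. 1. There is a constant $K(\theta)>0$, independent of $N$, $d$ and $f$, such that for all $N\ge1$, all $d\in\{1,\dots,N\}$ and all bounded measurable $f:\mathbb R^N\to\mathbb R$, $$\big|\langle f\rangle-\langle f\rangle_d\big|\le K(\theta)\,\|f\|_\infty\Big(\frac1{\sqrt N}+\sqrt{a_N(\theta)}\Big),\qquad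 \|f\|_\infty=\sup_{g}|f(g)|.$$ 2. For all $N\ge1$ and $d\in\{1,\dots,N\}$, under the Gibbs measure of $H_d$ the $d$-th coordinate is an independent Gaussian: $1+2\theta(v(\theta)-\gamma_d)>0$, $e^{\theta H_d}$ is $G$-integrable, and for all bounded measurable $\varphi:\mathbb R\to\mathbb R$ and $\psi:\mathbb R^{N-1}\to\mathbb R$, $$\langle\varphi(g_d)\,\psi(\bar g)\rangle_d=\Big(\int_{\mathbb R}\varphi\,d\mu_{\gamma_d}\Big)\,\langle\psi(\bar g)\rangle_d,$$ where $\mu_{\gamma_d}$ is the centred normal law of variance $1/(1+2\theta(v(\theta)-\gamma_d))$. -/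

import Mathlib

open MeasureTheory ProbabilityTheory Filter Topology
open scoped ENNReal NNReal

noncomputable section

namespace SphericalModel

/-- The 1-Wasserstein distance between two measures on `ℝ`: the infimum of the transport cost
`∫ |x - y| dπ(x, y)` over all couplings `π`. -/
def wasserstein1 (μ ν : Measure ℝ) : ℝ≥0∞ :=
  ⨅ (π : Measure (ℝ × ℝ)) (_ : π.map Prod.fst = μ) (_ : π.map Prod.snd = ν),
    ∫⁻ p, edist p.1 p.2 ∂π

/-- The empirical measure `N⁻¹ ∑ᵢ δ_{γᵢ}`. -/
def empiricalMeasure {N : ℕ} (γ : Fin N → ℝ) : Measure ℝ :=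
  (N : ℝ≥0∞)⁻¹ • ∑ i, Measure.dirac (γ i)

/-- Hypothesis on the triangular array of eigenvalues `γ N i` (`i < N`): all of them lie in
`[0, γt]`, and their empirical measures converge to `ρ` in the 1-Wasserstein metric. -/
structure EigenvalueHypothesis (γt : ℝ) (γ : (N : ℕ) → Fin N → ℝ) (ρ : Measure ℝ) : Prop where
  mem_Icc : ∀ N i, γ N i ∈ Set.Icc 0 γt
  tendsto : Tendsto (fun N => wasserstein1 (empiricalMeasure (γ N)) ρ) atTop (𝓝 0)

/-- The Stieltjes transform `S_ρ(z) = ∫_{[0, γt]} ρ(dγ) / (z - γ)`, used for `z ∉ [0, γt]`. -/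
def stieltjes (γt : ℝ) (ρ : Measure ℝ) (z : ℝ) : ℝ :=
  ∫ x in Set.Icc 0 γt, 1 / (z - x) ∂ρ

/-- `S_max = lim_{z ↓ γt} S_ρ(z)`, possibly `+∞`. -/
def Smax (γt : ℝ) (ρ : Measure ℝ) : EReal :=
  limUnder (𝓝[>] γt) (fun z => (stieltjes γt ρ z : EReal))

/-- `S_min = lim_{z ↑ 0} S_ρ(z)`, possibly `-∞`. -/
def Smin (γt : ℝ) (ρ : Measure ℝ) : EReal :=
  limUnder (𝓝[<] (0 : ℝ)) (fun z => (stieltjes γt ρ z : EReal))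

/-- `K_ρ`: the inverse of the bijection `S_ρ : ℝ \ [0, γt] → (S_min, S_max) \ {0}`. -/
def Kinv (γt : ℝ) (ρ : Measure ℝ) : ℝ → ℝ :=
  Function.invFunOn (stieltjes γt ρ) (Set.Icc 0 γt)ᶜ

/-- The R-transform `R_ρ(x) = K_ρ(x) - 1 / x`, used for `x ∈ (S_min, S_max) \ {0}`. -/
def Rtransform (γt : ℝ) (ρ : Measure ℝ) (x : ℝ) : ℝ :=
  Kinv γt ρ x - 1 / x

/-- The high-temperature region `T_ρ = (S_min / 2, S_max / 2) \ {0}`. -/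
def highTemp (γt : ℝ) (ρ : Measure ℝ) : Set ℝ :=
  {θ | Smin γt ρ < ((2 * θ : ℝ) : EReal) ∧ ((2 * θ : ℝ) : EReal) < Smax γt ρ ∧ θ ≠ 0}

/-- The limiting intensive energy `v(θ) = R_ρ(2θ)`. -/
def vlim (γt : ℝ) (ρ : Measure ℝ) (θ : ℝ) : ℝ :=
  Rtransform γt ρ (2 * θ)

/-- The standard normal measure `G` on `ℝᴺ`. -/
def stdNormal (N : ℕ) : Measure (Fin N → ℝ) :=
  Measure.pi fun _ => gaussianReal 0 1

/-- The Gibbs mean at temperature `θ` of `f` for the Hamiltonian `H`, with respect to the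
standard normal measure. -/
def gibbsMean {N : ℕ} (θ : ℝ) (H f : (Fin N → ℝ) → ℝ) : ℝ :=
  (∫ g, Real.exp (θ * H g) ∂stdNormal N)⁻¹ *
    ∫ g, f g * Real.exp (θ * H g) ∂stdNormal N

/-- The Hamiltonian `H_N(g) = N ∑ᵢ γᵢ gᵢ² / ‖g‖²` (Euclidean norm). -/
def HN {N : ℕ} (γ : Fin N → ℝ) (g : Fin N → ℝ) : ℝ :=
  N * ∑ i, γ i * (g i ^ 2 / ∑ j, g j ^ 2)

/-- The intensive energy `h_N = H_N / N`. -/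
def hN {N : ℕ} (γ : Fin N → ℝ) (g : Fin N → ℝ) : ℝ :=
  HN γ g / N

/-- The Hamiltonian with the `d`-th spin decoupled,
`H_d(g) = N ∑_{i ≠ d} γᵢ gᵢ² / ‖ḡ‖² - (v - γ_d) g_d²`, where `ḡ` is `g` without its
`d`-th coordinate. -/
def Hd {N : ℕ} (γ : Fin N → ℝ) (v : ℝ) (d : Fin N) (g : Fin N → ℝ) : ℝ :=
  N * ∑ i ∈ Finset.univ.erase d, γ i * (g i ^ 2 / ∑ j ∈ Finset.univ.erase d, g j ^ 2)
    - (v - γ d) * g d ^ 2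

/-- `a_N(θ) = ⟨(h_N - v(θ))²⟩_θ`. -/
def aN (γt : ℝ) (ρ : Measure ℝ) {N : ℕ} (γ : Fin N → ℝ) (θ : ℝ) : ℝ :=
  gibbsMean θ (HN γ) fun g => (hN γ g - vlim γt ρ θ) ^ 2

end SphericalModel

end

open SphericalModel

/-! Split `g` into `x = g d` and the rest `y`. With `s = x² / (x² + ‖y‖²)`, the Rayleigh quotient of
`g` is that of `y` minus `s * (rayleigh y - γ_d)`, so the coupled Boltzmann weight is `exp (θ N
rayleigh y)` times `exp (-θ N s (rayleigh y - γ_d))`. If `‖y‖²` is close to `N` and `rayleigh y` to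
`v`, then `N s` is close to `x²` and the second factor to `exp (-θ (v - γ_d) x²)`, which is the
decoupled weight. The latter is a product, with a Gaussian factor in `x`; this gives the
independence statement (`gibbsMean_Hd_mul`).

High temperature enters through `exists_precision_lower_bound`: the precisions `1 + 2θ(v - γ_d)` are
at least some `c > 0` uniformly in `N` and `d`. While the fluctuation `Y` of `y` is small compared
with `c`, both one-coordinate factors stay integrable against the standard normal law and differ by
`O(Y)` times an integrable Gaussian envelope (`abs_kernel_sub_le`). Where `Y` is not small, each
weight is bounded separately, as in Markov's inequality (`abs_weight_sub_le`).

The mean of `Y` under the coupled measure is `O(1/√N + √a_N)` (`integral_fluctuation_le`):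
Cauchy–Schwarz bounds the energy deviation by `√a_N`; the radius is `χ²` and independent of the
direction, so its relative deviation is `O(1/√N)`; and Gaussian integration by parts bounds the mean
overlap `s` (`integral_overlap_le`).

The decoupled weight also produces integrals over `y` alone. On `‖y‖² ≥ N/2` they are controlled by
the coupled measure, since adding one coordinate changes the exponent by `O(x²)`
(`indicator_mul_exp_le`); the complement is handled by the `χ²` variance. The resulting `L¹` bound
on the weights becomes a bound on normalized means through `abs_weighted_mean_sub_le`. -/

namespace SphericalModel

/-! ### The Stieltjes transform and the uniform bound on the precisions. -/

section Stieltjes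

variable {γt : ℝ} {ρ : Measure ℝ}

lemma abs_one_div_sub_le {δ z x : ℝ} (hδ : 0 < δ) (h : δ ≤ |z - x|) :
    ‖1 / (z - x)‖ ≤ 1 / δ := by
  rw [Real.norm_eq_abs, abs_div, abs_one]
  exact one_div_le_one_div_of_le hδ h

lemma integrableOn_one_div_sub [IsProbabilityMeasure ρ] {δ z : ℝ} (hδ : 0 < δ)
    (h : ∀ x ∈ Set.Icc 0 γt, δ ≤ |z - x|) :
    IntegrableOn (fun x => 1 / (z - x)) (Set.Icc 0 γt) ρ := by
  refine Integrable.of_bound (C := 1 / δ) (Measurable.aestronglyMeasurable (by fun_prop)) ?_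
  filter_upwards [ae_restrict_mem measurableSet_Icc] with x hx
  exact abs_one_div_sub_le hδ (h x hx)

lemma abs_stieltjes_le [IsProbabilityMeasure ρ] {δ z : ℝ} (hδ : 0 < δ)
    (h : ∀ x ∈ Set.Icc 0 γt, δ ≤ |z - x|) : |stieltjes γt ρ z| ≤ 1 / δ := by
  have h1 := norm_setIntegral_le_of_norm_le_const (μ := ρ) (s := Set.Icc 0 γt)
    (f := fun x => 1 / (z - x)) (C := 1 / δ) (measure_lt_top _ _)
    (fun x hx => abs_one_div_sub_le hδ (h x hx))
  refine (show |stieltjes γt ρ z| ≤ _ from h1).trans ?_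
  exact mul_le_of_le_one_right (by positivity) measureReal_le_one

lemma continuousOn_stieltjes [IsProbabilityMeasure ρ] {δ : ℝ} (hδ : 0 < δ) {s : Set ℝ}
    (h : ∀ z ∈ s, ∀ x ∈ Set.Icc 0 γt, δ ≤ |z - x|) : ContinuousOn (stieltjes γt ρ) s := by
  unfold stieltjes
  refine continuousOn_of_dominated (bound := fun _ => 1 / δ)
    (fun z _ => Measurable.aestronglyMeasurable (by fun_prop)) (fun z hz => ?_)
    (integrable_const _) ?_
  · filter_upwards [ae_restrict_mem measurableSet_Icc] with x hx
    exact abs_one_div_sub_le hδ (h z hz x hx)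
  · filter_upwards [ae_restrict_mem measurableSet_Icc] with x hx z hz
    have := h z hz x hx
    have h0 : z - x ≠ 0 := fun h0 => by rw [h0, abs_zero] at this; linarith
    have hc : ContinuousAt (fun z => 1 / (z - x)) z := by fun_prop (disch := exact h0)
    exact hc.continuousWithinAt

lemma le_abs_sub_of_add_le {δ z x : ℝ} (hz : γt + δ ≤ z) (hx : x ∈ Set.Icc 0 γt) :
    δ ≤ |z - x| := le_abs.2 (Or.inl (by linarith [hx.2]))

lemma le_abs_sub_of_le_neg {δ z x : ℝ} (hz : z ≤ -δ) (hx : x ∈ Set.Icc 0 γt) :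
    δ ≤ |z - x| := le_abs.2 (Or.inr (by linarith [hx.1]))

lemma antitoneOn_stieltjes_Ioi [IsProbabilityMeasure ρ] :
    AntitoneOn (stieltjes γt ρ) (Set.Ioi γt) := by
  intro z hz z' hz' hle
  simp only [Set.mem_Ioi] at hz hz'
  refine setIntegral_mono_on
    (integrableOn_one_div_sub (sub_pos.2 hz') fun x hx => le_abs_sub_of_add_le (by linarith) hx)
    (integrableOn_one_div_sub (sub_pos.2 hz) fun x hx => le_abs_sub_of_add_le (by linarith) hx)
    measurableSet_Icc fun x hx => ?_
  exact one_div_le_one_div_of_le (by linarith [hx.2]) (by linarith)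

lemma antitoneOn_stieltjes_Iio [IsProbabilityMeasure ρ] :
    AntitoneOn (stieltjes γt ρ) (Set.Iio 0) := by
  intro z hz z' hz' hle
  simp only [Set.mem_Iio] at hz hz'
  refine setIntegral_mono_on
    (integrableOn_one_div_sub (neg_pos.2 hz') fun x hx => le_abs_sub_of_le_neg (by linarith) hx)
    (integrableOn_one_div_sub (neg_pos.2 hz) fun x hx => le_abs_sub_of_le_neg (by linarith) hx)
    measurableSet_Icc fun x hx => ?_
  exact one_div_le_one_div_of_neg_of_le (by linarith [hx.1]) (by linarith)

/-- Intermediate value theorem: near the edge the transform exceeds `t`, and at distance `1 / t`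
from the edge it is at most `t`. -/
lemma exists_stieltjes_eq_of_pos [IsProbabilityMeasure ρ] {t : ℝ} (ht : 0 < t)
    (h : (t : EReal) < Smax γt ρ) : ∃ z, γt < z ∧ stieltjes γt ρ z = t := by
  -- Monotonicity guarantees a limit in `EReal`, so the `limUnder` is a genuine limit and not a
  -- default value.
  have hlim : Tendsto (fun z => (stieltjes γt ρ z : EReal)) (𝓝[>] γt) (𝓝 (Smax γt ρ)) := by
    have hanti : AntitoneOn (fun z => (stieltjes γt ρ z : EReal)) (Set.Ioi γt) :=
      fun a ha b hb hab => EReal.coe_le_coe_iff.2 (antitoneOn_stieltjes_Ioi ha hb hab)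
    exact tendsto_nhds_limUnder ⟨_, hanti.tendsto_nhdsGT (OrderTop.bddAbove _)⟩
  obtain ⟨z₁, hz₁, hS₁⟩ := ((hlim.eventually_const_lt h).and self_mem_nhdsWithin).exists
  simp only [EReal.coe_lt_coe_iff] at hz₁ hS₁
  have hδ : 0 < z₁ - γt := sub_pos.2 hS₁
  set z₂ := max z₁ (γt + 1 / t)
  have hS₂ : stieltjes γt ρ z₂ ≤ t := by
    have := abs_stieltjes_le (ρ := ρ) (γt := γt) (z := z₂) (one_div_pos.2 ht)
      fun x hx => le_abs_sub_of_add_le (le_max_right _ _) hx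
    rw [one_div_one_div] at this
    exact (le_abs_self _).trans this
  have hcont : ContinuousOn (stieltjes γt ρ) (Set.Icc z₁ z₂) :=
    continuousOn_stieltjes hδ fun z hz x hx => le_abs_sub_of_add_le (by linarith [hz.1]) hx
  obtain ⟨z, hz, hzt⟩ := intermediate_value_Icc' (le_max_left _ _) hcont ⟨hS₂, hz₁.le⟩
  exact ⟨z, by linarith [hz.1], hzt⟩

lemma exists_stieltjes_eq_of_neg [IsProbabilityMeasure ρ] {t : ℝ} (ht : t < 0)
    (h : Smin γt ρ < (t : EReal)) : ∃ z, z < 0 ∧ stieltjes γt ρ z = t := by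
  have hlim : Tendsto (fun z => (stieltjes γt ρ z : EReal)) (𝓝[<] 0) (𝓝 (Smin γt ρ)) := by
    have hanti : AntitoneOn (fun z => (stieltjes γt ρ z : EReal)) (Set.Iio 0) :=
      fun a ha b hb hab => EReal.coe_le_coe_iff.2 (antitoneOn_stieltjes_Iio ha hb hab)
    exact tendsto_nhds_limUnder ⟨_, hanti.tendsto_nhdsLT (OrderBot.bddBelow _)⟩
  obtain ⟨z₁, hz₁, hS₁⟩ := ((hlim.eventually_lt_const h).and self_mem_nhdsWithin).exists
  simp only [EReal.coe_lt_coe_iff] at hz₁ hS₁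
  have hδ : 0 < -z₁ := neg_pos.2 hS₁
  set z₂ := min z₁ (1 / t)
  have hS₂ : t ≤ stieltjes γt ρ z₂ := by
    have := abs_stieltjes_le (ρ := ρ) (γt := γt) (z := z₂) (one_div_pos.2 (neg_pos.2 ht))
      fun x hx => le_abs_sub_of_le_neg
        ((min_le_right _ _).trans (by rw [one_div_neg_eq_neg_one_div, neg_neg])) hx
    rw [one_div_one_div] at this
    linarith [neg_abs_le (stieltjes γt ρ z₂)]
  have hcont : ContinuousOn (stieltjes γt ρ) (Set.Icc z₂ z₁) :=
    continuousOn_stieltjes hδ fun z hz x hx => le_abs_sub_of_le_neg (by linarith [hz.2]) hx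
  obtain ⟨z, hz, hzt⟩ := intermediate_value_Icc' (min_le_left _ _) hcont ⟨hz₁.le, hS₂⟩
  exact ⟨z, by linarith [hz.2], hzt⟩

lemma stieltjes_nonneg {z : ℝ} (hz : γt ≤ z) : 0 ≤ stieltjes γt ρ z :=
  setIntegral_nonneg measurableSet_Icc fun x hx => one_div_nonneg.2 (by linarith [hx.2])

lemma stieltjes_nonpos {z : ℝ} (hz : z ≤ 0) : stieltjes γt ρ z ≤ 0 :=
  setIntegral_nonpos measurableSet_Icc fun x hx => one_div_nonpos.2 (by linarith [hx.1])

lemma Kinv_spec {t : ℝ} (h : ∃ z ∈ (Set.Icc 0 γt)ᶜ, stieltjes γt ρ z = t) :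
    Kinv γt ρ t ∈ (Set.Icc 0 γt)ᶜ ∧ stieltjes γt ρ (Kinv γt ρ t) = t :=
  ⟨Function.invFunOn_mem h, Function.invFunOn_eq h⟩

/-- In the high-temperature region the precisions `1 + 2θ(v(θ) - x)`, `x ∈ [0, γt]`, are bounded
away from zero. -/
lemma exists_precision_lower_bound [IsProbabilityMeasure ρ] {θ : ℝ}
    (hθ : θ ∈ highTemp γt ρ) :
    ∃ c, 0 < c ∧ c ≤ 1 ∧ ∀ x ∈ Set.Icc 0 γt, c ≤ 1 + 2 * θ * (vlim γt ρ θ - x) := by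
  obtain ⟨hmin, hmax, h0⟩ := hθ
  -- The term `-1 / (2θ)` of the R-transform cancels the 1. It remains to see that `K_ρ(2θ)` lies
  -- strictly outside `[0, γt]`, on the side given by the sign of `θ`.
  have key : ∀ x, 1 + 2 * θ * (vlim γt ρ θ - x) = 2 * θ * (Kinv γt ρ (2 * θ) - x) := by
    intro x
    unfold vlim Rtransform
    field_simp
    ring
  suffices ∃ c, 0 < c ∧ ∀ x ∈ Set.Icc 0 γt, c ≤ 1 + 2 * θ * (vlim γt ρ θ - x) by
    obtain ⟨c, hc, h⟩ := this
    exact ⟨min c 1, by positivity, min_le_right _ _, fun x hx => (min_le_left _ _).trans (h x hx)⟩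
  rcases lt_or_gt_of_ne h0 with hneg | hpos
  · obtain ⟨z, hz, hzt⟩ := exists_stieltjes_eq_of_neg (by linarith) hmin
    obtain ⟨hK, hSK⟩ := Kinv_spec ⟨z, fun h => by linarith [h.1], hzt⟩
    have hK0 : Kinv γt ρ (2 * θ) < 0 := by
      by_contra! hcon
      have : γt < Kinv γt ρ (2 * θ) := by
        by_contra! h'
        exact hK ⟨hcon, h'⟩
      linarith [stieltjes_nonneg (ρ := ρ) this.le]
    refine ⟨2 * θ * Kinv γt ρ (2 * θ), by nlinarith, fun x hx => ?_⟩
    rw [key]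
    nlinarith [hx.1]
  · obtain ⟨z, hz, hzt⟩ := exists_stieltjes_eq_of_pos (by linarith) hmax
    obtain ⟨hK, hSK⟩ := Kinv_spec ⟨z, fun h => by linarith [h.2], hzt⟩
    have hK0 : γt < Kinv γt ρ (2 * θ) := by
      by_contra! hcon
      have : Kinv γt ρ (2 * θ) < 0 := by
        by_contra! h'
        exact hK ⟨h', hcon⟩
      linarith [stieltjes_nonpos (γt := γt) (ρ := ρ) this.le]
    refine ⟨2 * θ * (Kinv γt ρ (2 * θ) - γt), by nlinarith, fun x hx => ?_⟩
    rw [key]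
    nlinarith [hx.2]

end Stieltjes

/-! ### Quadratic exponential tilts of the standard normal law on the line. -/

section GaussianTilt

variable {b : ℝ}

/-- Tilting the standard normal law by `exp (-b x²)` gives, up to normalization, the centred normal
law of variance `1 / (1 + 2b)`. -/
lemma gaussianReal_withDensity_exp_neg_sq (hb : 0 < 1 + 2 * b) :
    (gaussianReal 0 1).withDensity (fun x => ENNReal.ofReal (Real.exp (-(b * x ^ 2)))) =
      ENNReal.ofReal (√(1 + 2 * b))⁻¹ • gaussianReal 0 (Real.toNNReal (1 / (1 + 2 * b))) := by
  have hv : Real.toNNReal (1 / (1 + 2 * b)) ≠ 0 := by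
    rw [Ne, Real.toNNReal_eq_zero, not_le]; positivity
  rw [gaussianReal_of_var_ne_zero 0 one_ne_zero, gaussianReal_of_var_ne_zero 0 hv,
    ← withDensity_mul _ (measurable_gaussianPDF _ _) (by fun_prop),
    ← withDensity_smul _ (measurable_gaussianPDF _ _)]
  congr 1
  ext x
  simp only [Pi.mul_apply, Pi.smul_apply, smul_eq_mul, gaussianPDF, gaussianPDFReal]
  rw [← ENNReal.ofReal_mul (by positivity), ← ENNReal.ofReal_mul (by positivity)]
  congr 1
  rw [Real.coe_toNNReal _ (by positivity), mul_assoc, ← Real.exp_add, ← mul_assoc, ← mul_inv,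
    ← Real.sqrt_mul hb.le]
  congr 1
  · congr 2
    push_cast
    field_simp
  · congr 1
    push_cast
    field_simp
    ring

lemma integrable_exp_neg_sq_gaussianReal (hb : 0 < 1 + 2 * b) :
    Integrable (fun x => Real.exp (-(b * x ^ 2))) (gaussianReal 0 1) := by
  refine ⟨by fun_prop, ?_⟩
  rw [hasFiniteIntegral_iff_ofReal (ae_of_all _ fun x => (Real.exp_pos _).le)]
  have h := congrArg (fun μ : Measure ℝ => μ Set.univ) (gaussianReal_withDensity_exp_neg_sq hb)
  simp only [withDensity_apply _ MeasurableSet.univ, Measure.restrict_univ] at h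
  rw [h, Measure.smul_apply, measure_univ, smul_eq_mul, mul_one]
  exact ENNReal.ofReal_lt_top

lemma integral_mul_exp_neg_sq_gaussianReal (hb : 0 < 1 + 2 * b) (φ : ℝ → ℝ) :
    ∫ x, φ x * Real.exp (-(b * x ^ 2)) ∂gaussianReal 0 1 =
      (√(1 + 2 * b))⁻¹ * ∫ x, φ x ∂gaussianReal 0 (Real.toNNReal (1 / (1 + 2 * b))) := by
  have h := congrArg (fun μ : Measure ℝ => ∫ x, φ x ∂μ) (gaussianReal_withDensity_exp_neg_sq hb)
  simp only [integral_smul_measure] at h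
  rw [integral_withDensity_eq_integral_toReal_smul (by fun_prop)
    (ae_of_all _ fun _ => ENNReal.ofReal_lt_top), ENNReal.toReal_ofReal (by positivity),
    smul_eq_mul] at h
  rw [← h]
  congr 1 with x
  rw [ENNReal.toReal_ofReal (Real.exp_pos _).le, smul_eq_mul, mul_comm]

lemma integral_exp_neg_sq_gaussianReal (hb : 0 < 1 + 2 * b) :
    ∫ x, Real.exp (-(b * x ^ 2)) ∂gaussianReal 0 1 = (√(1 + 2 * b))⁻¹ := by
  simpa using integral_mul_exp_neg_sq_gaussianReal hb (fun _ => 1)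

/-- The tilted law is a multiple of the image of the standard one under a dilation. The `ℝ≥0∞` form
can be iterated over coordinates without integrability conditions. -/
lemma lintegral_mul_exp_neg_sq_gaussianReal (hb : 0 < 1 + 2 * b) {f : ℝ → ℝ≥0∞}
    (hf : Measurable f) :
    ∫⁻ x, f x * ENNReal.ofReal (Real.exp (-(b * x ^ 2))) ∂gaussianReal 0 1 =
      ENNReal.ofReal (√(1 + 2 * b))⁻¹ * ∫⁻ x, f ((√(1 + 2 * b))⁻¹ * x) ∂gaussianReal 0 1 := by
  have h := congrArg (fun μ : Measure ℝ => ∫⁻ x, f x ∂μ) (gaussianReal_withDensity_exp_neg_sq hb)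
  simp only [lintegral_smul_measure] at h
  rw [lintegral_withDensity_eq_lintegral_mul _ (by fun_prop) hf] at h
  simp only [Pi.mul_apply] at h
  simp_rw [mul_comm (f _)]
  rw [h, smul_eq_mul]
  congr 1
  have hmap := gaussianReal_map_const_mul (μ := 0) (v := 1) (√(1 + 2 * b))⁻¹
  rw [mul_zero] at hmap
  have hvar : NNReal.mk ((√(1 + 2 * b))⁻¹ ^ 2) (sq_nonneg _) * 1 =
      Real.toNNReal (1 / (1 + 2 * b)) := by
    ext
    rw [Real.coe_toNNReal _ (by positivity)]
    simp [Real.sq_sqrt hb.le]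
  rw [← hvar, ← hmap, lintegral_map hf (by fun_prop)]

end GaussianTilt

/-! ### Separating one coordinate of the Gaussian vector. -/

section Split

variable {n : ℕ} (d : Fin (n + 1))

instance isProbabilityMeasure_stdNormal (N : ℕ) : IsProbabilityMeasure (stdNormal N) := by unfold stdNormal; infer_instance

/-- The vector with `d`-th coordinate `p.1` and the remaining coordinates `p.2`. -/
def insertCoord (p : ℝ × (Fin n → ℝ)) : Fin (n + 1) → ℝ := d.insertNth p.1 p.2

@[simp] lemma insertCoord_same (p : ℝ × (Fin n → ℝ)) : insertCoord d p d = p.1 := by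
  simp [insertCoord]

@[simp] lemma insertCoord_succAbove (p : ℝ × (Fin n → ℝ)) (j : Fin n) :
    insertCoord d p (d.succAbove j) = p.2 j := by
  simp [insertCoord]

lemma measurableEmbedding_insertCoord : MeasurableEmbedding (insertCoord d) :=
  (MeasurableEquiv.piFinSuccAbove (fun _ : Fin (n + 1) => ℝ) d).symm.measurableEmbedding

lemma measurable_insertCoord : Measurable (insertCoord d) :=
  (measurableEmbedding_insertCoord d).measurable

lemma measurePreserving_insertCoord :
    MeasurePreserving (insertCoord d) ((gaussianReal 0 1).prod (stdNormal n))
      (stdNormal (n + 1)) :=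
  (measurePreserving_piFinSuccAbove (fun _ : Fin (n + 1) => gaussianReal 0 1) d).symm

lemma integral_stdNormal_succ (f : (Fin (n + 1) → ℝ) → ℝ) :
    ∫ g, f g ∂stdNormal (n + 1) =
      ∫ p, f (insertCoord d p) ∂(gaussianReal 0 1).prod (stdNormal n) :=
  ((measurePreserving_insertCoord d).integral_comp (measurableEmbedding_insertCoord d) f).symm

lemma lintegral_stdNormal_succ (f : (Fin (n + 1) → ℝ) → ℝ≥0∞) :
    ∫⁻ g, f g ∂stdNormal (n + 1) =
      ∫⁻ p, f (insertCoord d p) ∂(gaussianReal 0 1).prod (stdNormal n) :=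
  ((measurePreserving_insertCoord d).lintegral_comp_emb (measurableEmbedding_insertCoord d) f).symm

lemma integrable_stdNormal_succ_iff {f : (Fin (n + 1) → ℝ) → ℝ} :
    Integrable f (stdNormal (n + 1)) ↔
      Integrable (fun p => f (insertCoord d p)) ((gaussianReal 0 1).prod (stdNormal n)) :=
  ((measurePreserving_insertCoord d).integrable_comp_emb (measurableEmbedding_insertCoord d)).symm

lemma sum_insertCoord (F : Fin (n + 1) → ℝ → ℝ) (p : ℝ × (Fin n → ℝ)) :
    ∑ i, F i (insertCoord d p i) = F d p.1 + ∑ j, F (d.succAbove j) (p.2 j) := by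
  simp [Fin.sum_univ_succAbove _ d]

lemma sum_erase_insertCoord (F : Fin (n + 1) → ℝ → ℝ) (p : ℝ × (Fin n → ℝ)) :
    ∑ i ∈ Finset.univ.erase d, F i (insertCoord d p i) = ∑ j, F (d.succAbove j) (p.2 j) := by
  have h := Finset.add_sum_erase Finset.univ (fun i => F i (insertCoord d p i))
    (Finset.mem_univ d)
  rw [sum_insertCoord d F p, insertCoord_same] at h
  exact add_left_cancel h

end Split

/-! ### Independence of radius and direction. -/

section Radial

variable {n : ℕ}

/-- The squared Euclidean norm. -/
def normSq (y : Fin n → ℝ) : ℝ := ∑ j, y j ^ 2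

lemma normSq_nonneg (y : Fin n → ℝ) : 0 ≤ normSq y := Finset.sum_nonneg fun _ _ => sq_nonneg _

@[fun_prop]
lemma measurable_normSq : Measurable (normSq : (Fin n → ℝ) → ℝ) := by
  unfold normSq; fun_prop

lemma normSq_insertCoord (d : Fin (n + 1)) (p : ℝ × (Fin n → ℝ)) :
    normSq (insertCoord d p) = p.1 ^ 2 + normSq p.2 :=
  sum_insertCoord d (fun _ t => t ^ 2) p

lemma smul_insertCoord (t : ℝ) (d : Fin (n + 1)) (p : ℝ × (Fin n → ℝ)) :
    t • insertCoord d p = insertCoord d (t * p.1, t • p.2) := by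
  ext i
  refine Fin.succAboveCases d ?_ (fun j => ?_) i <;> simp

/-- The radial tilt factorizes over coordinates; induction on the dimension applies the
one-dimensional dilation to each in turn. -/
lemma lintegral_mul_exp_neg_normSq {b : ℝ} (hb : 0 < 1 + 2 * b) {f : (Fin n → ℝ) → ℝ≥0∞}
    (hf : Measurable f) :
    ∫⁻ y, f y * ENNReal.ofReal (Real.exp (-(b * normSq y))) ∂stdNormal n =
      ENNReal.ofReal (√(1 + 2 * b))⁻¹ ^ n * ∫⁻ y, f ((√(1 + 2 * b))⁻¹ • y) ∂stdNormal n := by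
  induction n with
  | zero =>
    simp only [pow_zero, one_mul]
    congr 1 with y
    rw [Subsingleton.elim y 0]
    simp [normSq]
  | succ n ih =>
    set σ := (√(1 + 2 * b))⁻¹
    have hins := measurable_insertCoord (0 : Fin (n + 1))
    have hexp : ∀ (x : ℝ) (y : Fin n → ℝ),
        ENNReal.ofReal (Real.exp (-(b * normSq (insertCoord 0 (x, y))))) =
          ENNReal.ofReal (Real.exp (-(b * x ^ 2))) *
            ENNReal.ofReal (Real.exp (-(b * normSq y))) := by
      intro x y
      rw [normSq_insertCoord, ← ENNReal.ofReal_mul (Real.exp_pos _).le, ← Real.exp_add]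
      congr 2
      ring
    rw [lintegral_stdNormal_succ 0, lintegral_stdNormal_succ 0,
      lintegral_prod_symm _ (by fun_prop), lintegral_prod _ (by fun_prop)]
    have h₁ : ∀ y : Fin n → ℝ,
        ∫⁻ x, f (insertCoord 0 (x, y)) *
          ENNReal.ofReal (Real.exp (-(b * normSq (insertCoord 0 (x, y))))) ∂gaussianReal 0 1 =
        ENNReal.ofReal σ * (∫⁻ x, f (insertCoord 0 (σ * x, y)) ∂gaussianReal 0 1) *
          ENNReal.ofReal (Real.exp (-(b * normSq y))) := by
      intro y
      rw [← lintegral_mul_exp_neg_sq_gaussianReal hb (f := fun x => f (insertCoord 0 (x, y)))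
        (by fun_prop), ← lintegral_mul_const _ (by fun_prop)]
      simp_rw [hexp, mul_assoc]
    simp_rw [h₁, mul_assoc]
    rw [lintegral_const_mul _ (by fun_prop)]
    have h₂ : ∀ y : Fin n → ℝ, (∫⁻ x, f (insertCoord 0 (σ * x, y)) ∂gaussianReal 0 1) *
          ENNReal.ofReal (Real.exp (-(b * normSq y))) =
        ∫⁻ x, f (insertCoord 0 (σ * x, y)) * ENNReal.ofReal (Real.exp (-(b * normSq y)))
          ∂gaussianReal 0 1 := fun y => by
      rw [lintegral_mul_const _ (by fun_prop)]
    simp_rw [h₂]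
    rw [lintegral_lintegral_swap (by fun_prop)]
    have h₃ : ∀ x : ℝ, ∫⁻ y, f (insertCoord 0 (σ * x, y)) *
          ENNReal.ofReal (Real.exp (-(b * normSq y))) ∂stdNormal n =
        ENNReal.ofReal σ ^ n * ∫⁻ y, f (insertCoord 0 (σ * x, σ • y)) ∂stdNormal n := fun x =>
      ih (f := fun y => f (insertCoord 0 (σ * x, y))) (by fun_prop)
    simp_rw [h₃]
    rw [lintegral_const_mul _ (by fun_prop), ← mul_assoc, pow_succ', mul_assoc, mul_assoc]
    simp_rw [smul_insertCoord]

variable {L : (Fin n → ℝ) → ℝ} {C : ℝ}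

/-- A weight of degree zero does not see the dilation, so what remains is the moment generating
function of the `χ²` law with `n` degrees of freedom. -/
lemma lintegral_exp_normSq_withDensity (hL : Measurable L)
    (hhom : ∀ t : ℝ, 0 < t → ∀ y, L (t • y) = L y) {s : ℝ} (hs : s < 1 / 2) :
    ∫⁻ y, ENNReal.ofReal (Real.exp (s * normSq y))
        ∂(stdNormal n).withDensity (fun y => ENNReal.ofReal (L y)) =
      ENNReal.ofReal (√(1 - 2 * s))⁻¹ ^ n *
        (stdNormal n).withDensity (fun y => ENNReal.ofReal (L y)) Set.univ := by
  have hb : 0 < 1 + 2 * (-s) := by linarith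
  rw [lintegral_withDensity_eq_lintegral_mul _ (by fun_prop) (by fun_prop),
    withDensity_apply _ MeasurableSet.univ, Measure.restrict_univ]
  have h := lintegral_mul_exp_neg_normSq (n := n) hb (f := fun y => ENNReal.ofReal (L y))
    (by fun_prop)
  simp only [neg_mul, neg_neg, mul_neg, ← sub_eq_add_neg] at h
  have hpos : 0 < (√(1 - 2 * s))⁻¹ := inv_pos.2 (Real.sqrt_pos.2 (by linarith))
  simp_rw [hhom _ hpos] at h
  exact h

/-- Moments of the squared norm against a bounded weight that only depends on the direction:
the radius is independent of the direction, and its square is `χ²`-distributed. -/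
lemma integral_normSq_mul_of_homogeneous (hL : Measurable L) (hL0 : ∀ y, 0 ≤ L y)
    (hLC : ∀ y, L y ≤ C) (hhom : ∀ t : ℝ, 0 < t → ∀ y, L (t • y) = L y) :
    Integrable (fun y => normSq y * L y) (stdNormal n) ∧
    Integrable (fun y => normSq y ^ 2 * L y) (stdNormal n) ∧
    ∫ y, normSq y * L y ∂stdNormal n = n * ∫ y, L y ∂stdNormal n ∧
    ∫ y, normSq y ^ 2 * L y ∂stdNormal n = n * (n + 2) * ∫ y, L y ∂stdNormal n := by
  set μ := (stdNormal n).withDensity (fun y => ENNReal.ofReal (L y)) with hμ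
  have hLint : Integrable L (stdNormal n) :=
    Integrable.of_bound hL.aestronglyMeasurable C
      (ae_of_all _ fun y => by rw [Real.norm_of_nonneg (hL0 y)]; exact hLC y)
  have hfin : IsFiniteMeasure μ := isFiniteMeasure_withDensity_ofReal hLint.2
  have hexp := fun s (hs : s < 1 / 2) => lintegral_exp_normSq_withDensity hL hhom hs
  -- The exponential moments are finite in a neighbourhood of 0, so the moment generating function
  -- may be differentiated under the integral; its first two derivatives at 0 are the moments
  -- sought.
  have hsub : Set.Iio (1 / 2) ⊆ integrableExpSet (normSq : (Fin n → ℝ) → ℝ) μ := by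
    intro s hs
    refine ⟨by fun_prop, ?_⟩
    rw [hasFiniteIntegral_iff_ofReal (ae_of_all _ fun x => (Real.exp_pos _).le), hexp s hs]
    exact ENNReal.mul_lt_top (ENNReal.pow_lt_top ENNReal.ofReal_lt_top) (measure_lt_top _ _)
  have hint : ∀ s < 1 / 2, s ∈ interior (integrableExpSet (normSq : (Fin n → ℝ) → ℝ) μ) :=
    fun s hs => interior_maximal hsub isOpen_Iio hs
  set I := μ.real Set.univ with hI
  have h0 : ∀ s < 1 / 2, ∫ y, normSq y ^ 0 * Real.exp (s * normSq y) ∂μ =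
      (√(1 - 2 * s))⁻¹ ^ n * I := by
    intro s hs
    simp only [pow_zero, one_mul]
    rw [integral_eq_lintegral_of_nonneg_ae (ae_of_all _ fun x => (Real.exp_pos _).le)
      (by fun_prop), hexp s hs, ENNReal.toReal_mul, ENNReal.toReal_pow,
      ENNReal.toReal_ofReal (by positivity), hI, Measure.real]
  have hpow : ∀ s < (1 : ℝ) / 2, HasDerivAt (fun s => (√(1 - 2 * s))⁻¹ ^ n * I)
      (n * (1 - 2 * s)⁻¹ * ((√(1 - 2 * s))⁻¹ ^ n * I)) s := by
    intro s hs
    have hp : 0 < 1 - 2 * s := by linarith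
    have hlin : HasDerivAt (fun s : ℝ => 1 - 2 * s) (-2) s := by
      simpa using ((hasDerivAt_id s).const_mul 2).const_sub 1
    have hsq := Real.sqrt_pos.2 hp
    have h : HasDerivAt (fun s => (√(1 - 2 * s))⁻¹ ^ n * I) _ s :=
      (((hlin.sqrt hp.ne').fun_inv hsq.ne').fun_pow n).mul_const I
    refine h.congr_deriv ?_
    have h2 := Real.sq_sqrt hp.le
    rcases n with _ | k
    · simp
    · rw [h2, Nat.add_sub_cancel, pow_succ]
      field_simp
  have h1 : ∀ s < 1 / 2, ∫ y, normSq y ^ 1 * Real.exp (s * normSq y) ∂μ =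
      n * (1 - 2 * s)⁻¹ * ((√(1 - 2 * s))⁻¹ ^ n * I) := by
    intro s hs
    refine (hasDerivAt_integral_pow_mul_exp_real (hint s hs) 0).unique
      ((hpow s hs).congr_of_eventuallyEq ?_)
    filter_upwards [Iio_mem_nhds hs] with t ht using h0 t ht
  have h2 : ∫ y, normSq y ^ 2 * Real.exp (0 * normSq y) ∂μ = n * (n + 2) * I := by
    have hder : HasDerivAt (fun s => n * (1 - 2 * s)⁻¹ * ((√(1 - 2 * s))⁻¹ ^ n * I))
        (n * (n + 2) * I) 0 := by
      have hlin : HasDerivAt (fun s : ℝ => 1 - 2 * s) (-2) 0 := by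
        simpa using ((hasDerivAt_id (0 : ℝ)).const_mul 2).const_sub 1
      have h : HasDerivAt (fun s => n * (1 - 2 * s)⁻¹ * ((√(1 - 2 * s))⁻¹ ^ n * I)) _ 0 :=
        ((hlin.fun_inv (by norm_num)).const_mul (n : ℝ)).fun_mul (hpow 0 (by norm_num))
      refine h.congr_deriv ?_
      simp
      ring
    refine (hasDerivAt_integral_pow_mul_exp_real (hint 0 (by norm_num)) 1).unique
      (hder.congr_of_eventuallyEq ?_)
    filter_upwards [Iio_mem_nhds (show (0 : ℝ) < 1 / 2 by norm_num)] with t ht using h1 t ht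
  have hIL : I = ∫ y, L y ∂stdNormal n := by
    rw [hI, Measure.real, hμ, withDensity_apply _ MeasurableSet.univ, Measure.restrict_univ,
      integral_eq_lintegral_of_nonneg_ae (ae_of_all _ hL0) hL.aestronglyMeasurable]
  have hconv : ∀ F : (Fin n → ℝ) → ℝ, ∫ y, F y ∂μ = ∫ y, F y * L y ∂stdNormal n := by
    intro F
    rw [hμ, integral_withDensity_eq_integral_toReal_smul (by fun_prop)
      (ae_of_all _ fun _ => ENNReal.ofReal_lt_top)]
    congr 1 with y
    rw [ENNReal.toReal_ofReal (hL0 y), smul_eq_mul, mul_comm]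
  have hconvI : ∀ k : ℕ, Integrable (fun y => normSq y ^ k * L y) (stdNormal n) := by
    intro k
    have hk : Integrable (fun y => normSq y ^ k) μ :=
      integrable_pow_of_mem_interior_integrableExpSet (hint 0 (by norm_num)) k
    rw [hμ, integrable_withDensity_iff (by fun_prop)
      (ae_of_all _ fun _ => ENNReal.ofReal_lt_top)] at hk
    refine hk.congr (ae_of_all _ fun y => ?_)
    simp only [ENNReal.toReal_ofReal (hL0 y)]
  refine ⟨by simpa using hconvI 1, hconvI 2, ?_, ?_⟩
  · have := h1 0 (by norm_num)
    simp only [pow_one, zero_mul, Real.exp_zero, mul_one, hconv, ← hIL] at this ⊢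
    rw [this]
    simp
  · simp only [zero_mul, Real.exp_zero, mul_one, hconv, ← hIL] at h2 ⊢
    exact h2

end Radial

/-! ### Rayleigh quotients and the effect of removing a coordinate. -/

section Rayleigh

variable {n : ℕ}

/-- The Rayleigh quotient `∑ⱼ γⱼ yⱼ² / ‖y‖²`. -/
noncomputable def rayleigh (γ : Fin n → ℝ) (y : Fin n → ℝ) : ℝ := ∑ j, γ j * (y j ^ 2 / normSq y)

@[fun_prop]
lemma measurable_rayleigh (γ : Fin n → ℝ) : Measurable (rayleigh γ) := by
  unfold rayleigh; fun_prop

lemma HN_eq (γ : Fin n → ℝ) (g : Fin n → ℝ) : HN γ g = n * rayleigh γ g := rfl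

lemma hN_eq (γ : Fin (n + 1) → ℝ) (g : Fin (n + 1) → ℝ) : hN γ g = rayleigh γ g := by
  rw [hN, HN_eq, mul_div_cancel_left₀]
  positivity

lemma Hd_insertCoord (γ : Fin (n + 1) → ℝ) (v : ℝ) (d : Fin (n + 1)) (p : ℝ × (Fin n → ℝ)) :
    Hd γ v d (insertCoord d p) =
      (n + 1) * rayleigh (fun j => γ (d.succAbove j)) p.2 - (v - γ d) * p.1 ^ 2 := by
  unfold Hd rayleigh
  have h₁ : ∑ j ∈ Finset.univ.erase d, insertCoord d p j ^ 2 = normSq p.2 :=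
    sum_erase_insertCoord d (fun _ t => t ^ 2) p
  rw [h₁, sum_erase_insertCoord d (fun i t => γ i * (t ^ 2 / normSq p.2)) p, insertCoord_same]
  push_cast
  rfl

lemma eq_zero_of_normSq_eq_zero {y : Fin n → ℝ} (h : normSq y = 0) : y = 0 := by
  ext j
  have := (Finset.sum_eq_zero_iff_of_nonneg fun i _ => sq_nonneg (y i)).1 h j (Finset.mem_univ j)
  simpa using this

lemma rayleigh_mul_normSq (γ : Fin n → ℝ) (y : Fin n → ℝ) :
    rayleigh γ y * normSq y = ∑ j, γ j * y j ^ 2 := by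
  by_cases h : normSq y = 0
  · simp [eq_zero_of_normSq_eq_zero h, normSq]
  · rw [rayleigh, Finset.sum_mul]
    refine Finset.sum_congr rfl fun j _ => ?_
    field_simp

lemma rayleigh_nonneg {γ : Fin n → ℝ} (hγ : ∀ j, 0 ≤ γ j) (y : Fin n → ℝ) :
    0 ≤ rayleigh γ y :=
  Finset.sum_nonneg fun j _ => mul_nonneg (hγ j) (div_nonneg (sq_nonneg _) (normSq_nonneg y))

lemma rayleigh_le {γ : Fin n → ℝ} {γt : ℝ} (h0 : 0 ≤ γt) (hγ : ∀ j, γ j ≤ γt)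
    (y : Fin n → ℝ) : rayleigh γ y ≤ γt := by
  calc rayleigh γ y ≤ ∑ j, γt * (y j ^ 2 / normSq y) :=
        Finset.sum_le_sum fun j _ =>
          mul_le_mul_of_nonneg_right (hγ j) (div_nonneg (sq_nonneg _) (normSq_nonneg y))
    _ = γt * (normSq y / normSq y) := by rw [← Finset.mul_sum, ← Finset.sum_div]; rfl
    _ ≤ γt := mul_le_of_le_one_right h0 (div_self_le_one _)

lemma normSq_smul (t : ℝ) (y : Fin n → ℝ) : normSq (t • y) = t ^ 2 * normSq y := by
  simp [normSq, mul_pow, Finset.mul_sum]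

lemma smul_sq_div_normSq {t : ℝ} (ht : 0 < t) (y : Fin n → ℝ) (j : Fin n) :
    (t • y) j ^ 2 / normSq (t • y) = y j ^ 2 / normSq y := by
  rw [normSq_smul, Pi.smul_apply, smul_eq_mul, mul_pow, mul_div_mul_left _ _ (by positivity)]

lemma rayleigh_smul (γ : Fin n → ℝ) {t : ℝ} (ht : 0 < t) (y : Fin n → ℝ) :
    rayleigh γ (t • y) = rayleigh γ y := by
  simp only [rayleigh, smul_sq_div_normSq ht]

lemma sq_div_normSq_le_one (y : Fin n → ℝ) (j : Fin n) : y j ^ 2 / normSq y ≤ 1 :=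
  div_le_one_of_le₀ (Finset.single_le_sum (f := fun j => y j ^ 2) (fun _ _ => sq_nonneg _)
    (Finset.mem_univ j)) (normSq_nonneg y)

lemma sq_div_normSq_nonneg (y : Fin n → ℝ) (j : Fin n) : 0 ≤ y j ^ 2 / normSq y :=
  div_nonneg (sq_nonneg _) (normSq_nonneg y)

lemma normSq_mul_sq_div_normSq (y : Fin n → ℝ) (j : Fin n) :
    normSq y * (y j ^ 2 / normSq y) = y j ^ 2 := by
  by_cases h : normSq y = 0
  · simp [eq_zero_of_normSq_eq_zero h]
  · field_simp

/-- The full quotient is the average of the reduced one and `γ d`, with the overlap as the weight of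
`γ d`. At the origin all the quotients are 0 by the convention on division by zero. -/
lemma rayleigh_insertCoord (γ : Fin (n + 1) → ℝ) (d : Fin (n + 1)) (p : ℝ × (Fin n → ℝ)) :
    rayleigh γ (insertCoord d p) = rayleigh (fun j => γ (d.succAbove j)) p.2 -
      p.1 ^ 2 / (p.1 ^ 2 + normSq p.2) *
        (rayleigh (fun j => γ (d.succAbove j)) p.2 - γ d) := by
  have h := rayleigh_mul_normSq γ (insertCoord d p)
  rw [sum_insertCoord d (fun i t => γ i * t ^ 2) p,
    ← rayleigh_mul_normSq (fun j => γ (d.succAbove j)) p.2, normSq_insertCoord] at h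
  by_cases h0 : p.1 ^ 2 + normSq p.2 = 0
  · have hy : normSq p.2 = 0 := by nlinarith [sq_nonneg p.1, normSq_nonneg p.2]
    rw [h0, div_zero, zero_mul, sub_zero]
    have hg : normSq (insertCoord d p) = 0 := by rw [normSq_insertCoord, h0]
    rw [eq_zero_of_normSq_eq_zero hg, eq_zero_of_normSq_eq_zero hy]
    simp [rayleigh]
  · field_simp
    rw [h]
    ring

end Rayleigh

/-! ### Gaussian integration by parts. -/

section Stein

lemma integral_stein {u u' : ℝ → ℝ} (hu : ∀ x, HasDerivAt u (u' x) x)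
    (hint : Integrable u (gaussianReal 0 1)) (hint' : Integrable u' (gaussianReal 0 1))
    (hxu : Integrable (fun x => x * u x) (gaussianReal 0 1)) :
    ∫ x, x * u x ∂gaussianReal 0 1 = ∫ x, u' x ∂gaussianReal 0 1 := by
  have hconv : ∀ f : ℝ → ℝ, Integrable f (gaussianReal 0 1) →
      Integrable (fun x => gaussianPDFReal 0 1 x * f x) := by
    intro f hf
    rw [gaussianReal_of_var_ne_zero 0 one_ne_zero,
      integrable_withDensity_iff_integrable_smul' (measurable_gaussianPDF _ _)
      (ae_of_all _ fun _ => gaussianPDF_lt_top)] at hf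
    simpa [toReal_gaussianPDF] using hf
  have hpdf : ∀ x, HasDerivAt (gaussianPDFReal 0 1) (-(x * gaussianPDFReal 0 1 x)) x := by
    intro x
    have h1 : HasDerivAt (fun x : ℝ => -(x - 0) ^ 2 / (2 * ((1 : ℝ≥0) : ℝ))) (-x) x := by
      refine (((((hasDerivAt_id x).sub_const 0).fun_pow 2).fun_neg).div_const
        (2 * ((1 : ℝ≥0) : ℝ))).congr_deriv ?_
      simp
      ring
    refine (h1.exp.const_mul (√(2 * Real.pi * ((1 : ℝ≥0) : ℝ)))⁻¹).congr_deriv ?_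
    rw [gaussianPDFReal]
    ring
  have h0 := integral_eq_zero_of_hasDerivAt_of_integrable (fun x => (hpdf x).fun_mul (hu x))
    (((hconv _ hint').sub (hconv _ hxu)).congr (ae_of_all _ fun x => by
      simp only [Pi.sub_apply]; ring)) (hconv _ hint)
  rw [← sub_eq_zero, ← integral_sub hxu hint', ← neg_eq_zero,
    integral_gaussianReal_eq_integral_smul one_ne_zero, ← integral_neg]
  refine Eq.trans (integral_congr_ae (ae_of_all _ fun x => ?_)) h0
  simp only [smul_eq_mul]
  ring

lemma integrable_mul_of_abs_le {α : Type*} [MeasurableSpace α] {μ : Measure α} {f g : α → ℝ}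
    {C : ℝ} (hf : Integrable f μ) (hg : Measurable g) (hC : ∀ x, |g x| ≤ C) :
    Integrable (fun x => f x * g x) μ :=
  hf.mul_bdd (c := C) hg.aestronglyMeasurable (ae_of_all _ hC)

lemma integrable_sq_gaussianReal : Integrable (fun x : ℝ => x ^ 2) (gaussianReal 0 1) :=
  (memLp_id_gaussianReal 2).integrable_sq

lemma integrable_id_gaussianReal : Integrable (fun x : ℝ => x) (gaussianReal 0 1) :=
  (memLp_id_gaussianReal 1).integrable le_rfl

/-- Integration by parts against the standard normal law, for the Boltzmann weight of one
coordinate with the others fixed. -/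
lemma integral_sq_mul_exp_gaussianReal {R : ℝ} (hR : 0 < R) (κ a η : ℝ) :
    ∫ x, x ^ 2 * Real.exp (κ * (a - x ^ 2 / (x ^ 2 + R) * (a - η))) ∂gaussianReal 0 1 =
      ∫ x, (1 + 2 * κ * (x ^ 2 / (x ^ 2 + R) * (η - (a - x ^ 2 / (x ^ 2 + R) * (a - η))))) *
        Real.exp (κ * (a - x ^ 2 / (x ^ 2 + R) * (a - η))) ∂gaussianReal 0 1 := by
  set E : ℝ → ℝ := fun x => Real.exp (κ * (a - x ^ 2 / (x ^ 2 + R) * (a - η))) with hE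
  have hs : ∀ x : ℝ, |x ^ 2 / (x ^ 2 + R)| ≤ 1 := fun x => by
    rw [abs_of_nonneg (by positivity)]
    exact div_le_one_of_le₀ (by linarith) (by positivity)
  have he : ∀ x : ℝ, |a - x ^ 2 / (x ^ 2 + R) * (a - η)| ≤ |a| + |a - η| := fun x => by
    refine (abs_sub _ _).trans (add_le_add_right ?_ _)
    rw [abs_mul]
    exact mul_le_of_le_one_left (abs_nonneg _) (hs x)
  have hEb : ∀ x, |E x| ≤ Real.exp (|κ| * (|a| + |a - η|)) := fun x => by
    rw [hE, Real.abs_exp]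
    refine Real.exp_le_exp.2 ((le_abs_self _).trans ?_)
    rw [abs_mul]
    exact mul_le_mul_of_nonneg_left (he x) (abs_nonneg _)
  have hEm : Measurable E := by fun_prop
  have hEint : Integrable E (gaussianReal 0 1) :=
    Integrable.of_bound hEm.aestronglyMeasurable _ (ae_of_all _ hEb)
  -- With `s = x² / (x² + R)` one has `x s' = 2 s (1 - s)`, and `(1 - s)(η - a)` equals `η` minus
  -- the full quotient.
  have hder : ∀ x, HasDerivAt (fun x => x * E x)
      ((1 + 2 * κ * (x ^ 2 / (x ^ 2 + R) * (η - (a - x ^ 2 / (x ^ 2 + R) * (a - η))))) * E x)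
      x := by
    intro x
    have hpos : x ^ 2 + R ≠ 0 := by positivity
    have hsq : HasDerivAt (fun x : ℝ => x ^ 2) (2 * x) x := by
      simpa using hasDerivAt_pow 2 x
    have h1 := (hsq.fun_div (hsq.add_const R) hpos).mul_const (a - η)
    have h2 : HasDerivAt E _ x := ((h1.const_sub a).const_mul κ).exp
    refine ((hasDerivAt_id x).fun_mul h2).congr_deriv ?_
    simp only [hE, id]
    field_simp
    ring
  have h := integral_stein hder (integrable_mul_of_abs_le integrable_id_gaussianReal hEm hEb) ?_ ?_
  · rw [← h]
    congr 1 with x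
    ring
  · simp_rw [mul_comm _ (E _)]
    refine integrable_mul_of_abs_le (C := 1 + 2 * |κ| * (|η| + (|a| + |a - η|))) hEint
      (by fun_prop) fun x => ?_
    refine (abs_add_le _ _).trans ?_
    rw [abs_one, abs_mul, abs_mul, abs_mul, abs_two]
    gcongr
    refine (mul_le_of_le_one_left (abs_nonneg _) (hs x)).trans ?_
    exact (abs_sub _ _).trans (add_le_add_right (he x) _)
  · have := integrable_mul_of_abs_le integrable_sq_gaussianReal hEm hEb
    refine this.congr (ae_of_all _ fun x => ?_)
    simp only
    ring

end Stein

/-! ### Bounds for the Boltzmann weight, and Cauchy–Schwarz. -/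

section Weight

variable {n : ℕ} {γ : Fin n → ℝ} {γt θ : ℝ}

lemma abs_rayleigh_le (h0 : 0 ≤ γt) (hγ : ∀ j, γ j ∈ Set.Icc 0 γt) (y : Fin n → ℝ) :
    |rayleigh γ y| ≤ γt := by
  rw [abs_of_nonneg (rayleigh_nonneg (fun j => (hγ j).1) y)]
  exact rayleigh_le h0 (fun j => (hγ j).2) y

lemma abs_rayleigh_sub_le (h0 : 0 ≤ γt) (hγ : ∀ j, γ j ∈ Set.Icc 0 γt) (v : ℝ)
    (y : Fin n → ℝ) : |rayleigh γ y - v| ≤ γt + |v| :=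
  (abs_sub _ _).trans (add_le_add_left (abs_rayleigh_le h0 hγ y) _)

lemma exp_rayleigh_le (h0 : 0 ≤ γt) (hγ : ∀ j, γ j ∈ Set.Icc 0 γt) (κ : ℝ) (y : Fin n → ℝ) :
    Real.exp (κ * rayleigh γ y) ≤ Real.exp (|κ| * γt) := by
  refine Real.exp_le_exp.2 ((le_abs_self _).trans ?_)
  rw [abs_mul]
  exact mul_le_mul_of_nonneg_left (abs_rayleigh_le h0 hγ y) (abs_nonneg _)

lemma integrable_exp_rayleigh (h0 : 0 ≤ γt) (hγ : ∀ j, γ j ∈ Set.Icc 0 γt) (κ : ℝ) :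
    Integrable (fun y => Real.exp (κ * rayleigh γ y)) (stdNormal n) :=
  Integrable.of_bound (by fun_prop) (Real.exp (|κ| * γt)) (ae_of_all _ fun y => by
    rw [Real.norm_eq_abs, Real.abs_exp]
    exact exp_rayleigh_le h0 hγ κ y)

lemma integrable_bdd_mul_exp_rayleigh (h0 : 0 ≤ γt) (hγ : ∀ j, γ j ∈ Set.Icc 0 γt) (κ : ℝ)
    {u : (Fin n → ℝ) → ℝ} {C : ℝ} (hu : Measurable u) (hC : ∀ y, |u y| ≤ C) :
    Integrable (fun y => u y * Real.exp (κ * rayleigh γ y)) (stdNormal n) := by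
  simp_rw [mul_comm (u _)]
  exact integrable_mul_of_abs_le (integrable_exp_rayleigh h0 hγ κ) hu hC

/-- Under the Gibbs measure the squared radius is `χ²`-distributed; its relative variance is
`2 / n`. -/
lemma integral_normSq_div_sub_one_sq (hn : 0 < n) (h0 : 0 ≤ γt)
    (hγ : ∀ j, γ j ∈ Set.Icc 0 γt) (κ : ℝ) :
    Integrable (fun y => (normSq y / n - 1) ^ 2 * Real.exp (κ * rayleigh γ y)) (stdNormal n) ∧
    ∫ y, (normSq y / n - 1) ^ 2 * Real.exp (κ * rayleigh γ y) ∂stdNormal n =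
      2 / n * ∫ y, Real.exp (κ * rayleigh γ y) ∂stdNormal n := by
  obtain ⟨i1, i2, e1, e2⟩ := integral_normSq_mul_of_homogeneous
    (L := fun y => Real.exp (κ * rayleigh γ y)) (C := Real.exp (|κ| * γt)) (by fun_prop)
    (fun y => (Real.exp_pos _).le) (exp_rayleigh_le h0 hγ κ)
    (fun t ht y => by rw [rayleigh_smul γ ht])
  have i0 := integrable_exp_rayleigh h0 hγ κ
  have hn' : (n : ℝ) ≠ 0 := by positivity
  have hexp : ∀ y : Fin n → ℝ, (normSq y / n - 1) ^ 2 * Real.exp (κ * rayleigh γ y) =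
      (1 / (n : ℝ) ^ 2) * (normSq y ^ 2 * Real.exp (κ * rayleigh γ y)) -
        (2 / (n : ℝ)) * (normSq y * Real.exp (κ * rayleigh γ y)) +
          Real.exp (κ * rayleigh γ y) := fun y => by
    field_simp
    ring
  simp_rw [hexp]
  refine ⟨((i2.const_mul _).sub' (i1.const_mul _)).add i0, ?_⟩
  rw [integral_add ((i2.const_mul _).sub' (i1.const_mul _)) i0,
    integral_sub (i2.const_mul _) (i1.const_mul _), integral_const_mul, integral_const_mul, e1, e2]
  field_simp
  ring

/-- Cauchy–Schwarz, obtained by expanding the nonnegative weighted variance of `|u|` around its mean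
`B / Z`. -/
lemma integral_abs_mul_le_sqrt {α : Type*} [MeasurableSpace α] {μ : Measure α} {u w : α → ℝ}
    (hw : ∀ x, 0 ≤ w x) (h0 : Integrable w μ) (h1 : Integrable (fun x => |u x| * w x) μ)
    (h2 : Integrable (fun x => u x ^ 2 * w x) μ) (hZ : 0 < ∫ x, w x ∂μ) :
    ∫ x, |u x| * w x ∂μ ≤
      (∫ x, w x ∂μ) * √((∫ x, w x ∂μ)⁻¹ * ∫ x, u x ^ 2 * w x ∂μ) := by
  set Z := ∫ x, w x ∂μ
  set B := ∫ x, |u x| * w x ∂μ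
  set A := ∫ x, u x ^ 2 * w x ∂μ
  have hB : 0 ≤ B := integral_nonneg fun x => mul_nonneg (abs_nonneg _) (hw x)
  have key : 0 ≤ A - 2 * (B / Z) * B + (B / Z) ^ 2 * Z := by
    rw [← integral_const_mul, ← integral_const_mul, ← integral_sub h2 (h1.const_mul _),
      ← integral_add (h2.sub' (h1.const_mul _)) (h0.const_mul _)]
    refine integral_nonneg fun x => ?_
    have : u x ^ 2 * w x - 2 * (B / Z) * (|u x| * w x) + (B / Z) ^ 2 * w x =
        (|u x| - B / Z) ^ 2 * w x := by
      rw [← sq_abs (u x)]; ring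
    simp only [Pi.zero_apply, this]
    exact mul_nonneg (sq_nonneg _) (hw x)
  have h3 : (B / Z) ^ 2 ≤ Z⁻¹ * A := by
    have : A - 2 * (B / Z) * B + (B / Z) ^ 2 * Z = Z * (Z⁻¹ * A - (B / Z) ^ 2) := by
      field_simp
      ring
    rw [this] at key
    linarith [nonneg_of_mul_nonneg_right key hZ]
  have h4 := Real.le_sqrt_of_sq_le h3
  rwa [div_le_iff₀' hZ] at h4

end Weight

/-! ### The mean overlap of the spin with a coordinate direction. -/

section Overlap

variable {n : ℕ} {γ : Fin (n + 1) → ℝ} {γt θ : ℝ}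

lemma ae_normSq_pos (hn : 0 < n) : ∀ᵐ y ∂stdNormal n, 0 < normSq y := by
  have := nullSingletonClass_gaussianReal (μ := 0) (v := 1) one_ne_zero
  have := Measure.ae_eval_ne (fun _ : Fin n => gaussianReal 0 1) ⟨0, hn⟩ 0
  filter_upwards [this] with y hy
  refine (normSq_nonneg y).lt_of_ne fun h => hy ?_
  rw [eq_zero_of_normSq_eq_zero h.symm]
  rfl

/-- Write `g d ^ 2` as the squared radius times the overlap. The overlap times the Boltzmann weight
depends only on the direction, so the radius contributes its mean `n + 1`. -/
lemma integral_overlap_moments (h0 : 0 ≤ γt) (hγ : ∀ j, γ j ∈ Set.Icc 0 γt) (κ : ℝ)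
    (d : Fin (n + 1)) :
    Integrable (fun g => g d ^ 2 * Real.exp (κ * rayleigh γ g)) (stdNormal (n + 1)) ∧
    ∫ g, g d ^ 2 * Real.exp (κ * rayleigh γ g) ∂stdNormal (n + 1) =
      (n + 1) * ∫ g, g d ^ 2 / normSq g * Real.exp (κ * rayleigh γ g) ∂stdNormal (n + 1) := by
  obtain ⟨i1, -, e1, -⟩ := integral_normSq_mul_of_homogeneous
    (L := fun g => g d ^ 2 / normSq g * Real.exp (κ * rayleigh γ g)) (C := Real.exp (|κ| * γt))
    (by fun_prop) (fun y => mul_nonneg (sq_div_normSq_nonneg _ _) (Real.exp_pos _).le)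
    (fun y => (mul_le_of_le_one_left (Real.exp_pos _).le (sq_div_normSq_le_one _ _)).trans
      (exp_rayleigh_le h0 hγ κ y))
    (fun t ht y => by rw [rayleigh_smul γ ht, smul_sq_div_normSq ht])
  simp_rw [← mul_assoc, normSq_mul_sq_div_normSq] at i1 e1
  refine ⟨i1, ?_⟩
  rw [e1]
  push_cast
  rfl

/-- The Schwinger–Dyson equation for the overlap `g_d² / ‖g‖²` with a coordinate direction. -/
lemma integral_overlap_eq (hn : 0 < n) (h0 : 0 ≤ γt) (hγ : ∀ j, γ j ∈ Set.Icc 0 γt) (κ : ℝ)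
    (d : Fin (n + 1)) :
    (n + 1) * ∫ g, g d ^ 2 / normSq g * Real.exp (κ * rayleigh γ g) ∂stdNormal (n + 1) =
      ∫ g, (1 + 2 * κ * (g d ^ 2 / normSq g * (γ d - rayleigh γ g))) *
        Real.exp (κ * rayleigh γ g) ∂stdNormal (n + 1) := by
  obtain ⟨i1, e1⟩ := integral_overlap_moments h0 hγ κ d
  have i2 : Integrable (fun g => (1 + 2 * κ * (g d ^ 2 / normSq g * (γ d - rayleigh γ g))) *
      Real.exp (κ * rayleigh γ g)) (stdNormal (n + 1)) := by
    refine integrable_bdd_mul_exp_rayleigh (C := 1 + 2 * |κ| * (γt + |γ d|)) h0 hγ κ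
      (by fun_prop) fun g => ?_
    refine (abs_add_le _ _).trans ?_
    rw [abs_one, abs_mul, abs_mul, abs_mul, abs_two, abs_sub_comm]
    gcongr
    rw [abs_of_nonneg (sq_div_normSq_nonneg _ _)]
    exact (mul_le_of_le_one_left (abs_nonneg _) (sq_div_normSq_le_one _ _)).trans
      (abs_rayleigh_sub_le h0 hγ _ _)
  rw [← e1, integral_stdNormal_succ d, integral_stdNormal_succ d, integral_prod_symm,
    integral_prod_symm]
  · refine integral_congr_ae ?_
    filter_upwards [ae_normSq_pos hn] with y hy
    have := integral_sq_mul_exp_gaussianReal hy κ (rayleigh (fun j => γ (d.succAbove j)) y) (γ d)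
    simpa only [insertCoord_same, rayleigh_insertCoord, normSq_insertCoord] using this
  · exact (integrable_stdNormal_succ_iff d).1 i2
  · exact (integrable_stdNormal_succ_iff d).1 i1

/-- Divide the Schwinger–Dyson equation by `n + 1` and replace the random energy by `v`. The overlap
then carries the coefficient `1 + 2θ(v - γ d) ≥ c`, and since it is at most 1 the replacement costs
at most `2|θ| |rayleigh - v|`. -/
lemma integral_overlap_le (hn : 0 < n) (h0 : 0 ≤ γt) (hγ : ∀ j, γ j ∈ Set.Icc 0 γt)
    (d : Fin (n + 1)) {v c : ℝ} (hc : c ≤ 1 + 2 * θ * (v - γ d)) {κ : ℝ}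
    (hκ : κ = θ * (n + 1)) :
    c * ∫ g, g d ^ 2 / normSq g * Real.exp (κ * rayleigh γ g) ∂stdNormal (n + 1) ≤
      1 / (n + 1) * ∫ g, Real.exp (κ * rayleigh γ g) ∂stdNormal (n + 1) +
      2 * |θ| * ∫ g, |rayleigh γ g - v| * Real.exp (κ * rayleigh γ g) ∂stdNormal (n + 1) := by
  have hsd := integral_overlap_eq hn h0 hγ κ d
  have i0 := integrable_exp_rayleigh h0 hγ κ
  have iS : Integrable (fun g => g d ^ 2 / normSq g * Real.exp (κ * rayleigh γ g))
      (stdNormal (n + 1)) :=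
    integrable_bdd_mul_exp_rayleigh (C := 1) h0 hγ κ (by fun_prop) fun g => by
      rw [abs_of_nonneg (sq_div_normSq_nonneg _ _)]
      exact sq_div_normSq_le_one _ _
  have iA : Integrable (fun g => |rayleigh γ g - v| * Real.exp (κ * rayleigh γ g))
      (stdNormal (n + 1)) :=
    integrable_bdd_mul_exp_rayleigh (C := γt + |v|) h0 hγ κ (by fun_prop) fun g => by
      rw [abs_abs]
      exact abs_rayleigh_sub_le h0 hγ _ _
  have iD : Integrable (fun g => g d ^ 2 / normSq g * (γ d - rayleigh γ g) *
      Real.exp (κ * rayleigh γ g)) (stdNormal (n + 1)) :=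
    integrable_bdd_mul_exp_rayleigh (C := γt + |γ d|) h0 hγ κ (by fun_prop) fun g => by
      rw [abs_mul, abs_sub_comm, abs_of_nonneg (sq_div_normSq_nonneg _ _)]
      exact (mul_le_of_le_one_left (abs_nonneg _) (sq_div_normSq_le_one _ _)).trans
        (abs_rayleigh_sub_le h0 hγ _ _)
  simp_rw [add_mul, one_mul, mul_assoc (2 * κ)] at hsd
  rw [integral_add i0 (iD.const_mul _), integral_const_mul] at hsd
  have hmono : ∫ g, c * (g d ^ 2 / normSq g * Real.exp (κ * rayleigh γ g)) ∂stdNormal (n + 1) ≤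
      ∫ g, ((g d ^ 2 / normSq g * Real.exp (κ * rayleigh γ g) -
        2 * θ * (g d ^ 2 / normSq g * (γ d - rayleigh γ g) * Real.exp (κ * rayleigh γ g))) +
        2 * |θ| * (|rayleigh γ g - v| * Real.exp (κ * rayleigh γ g))) ∂stdNormal (n + 1) := by
    refine integral_mono (iS.const_mul _) ((iS.sub' (iD.const_mul _)).add (iA.const_mul _))
      fun g => ?_
    simp only
    set s := g d ^ 2 / normSq g with hs
    set h := rayleigh γ g
    have hs0 : 0 ≤ s := sq_div_normSq_nonneg _ _
    have hs1 : s ≤ 1 := sq_div_normSq_le_one _ _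
    have h1 : s * (2 * θ * (v - h)) ≤ 2 * |θ| * |h - v| := by
      refine (le_abs_self _).trans ?_
      rw [abs_mul, abs_mul, abs_mul, abs_two, abs_sub_comm, abs_of_nonneg hs0]
      exact mul_le_of_le_one_left (by positivity) hs1
    have h2 : c * s ≤ s - 2 * θ * (s * (γ d - h)) + 2 * |θ| * |h - v| := by nlinarith
    have := mul_le_mul_of_nonneg_right h2 (Real.exp_pos (κ * h)).le
    calc _ = c * s * Real.exp (κ * h) := by ring
      _ ≤ _ := this
      _ = _ := by ring
  rw [integral_const_mul, integral_add (iS.sub' (iD.const_mul _)) (iA.const_mul _),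
    integral_sub iS (iD.const_mul _), integral_const_mul, integral_const_mul] at hmono
  have hN : (n : ℝ) + 1 ≠ 0 := by positivity
  have aux : ∀ S D Z : ℝ, n * S + S = Z + 2 * κ * D → S - 2 * θ * D = 1 / (n + 1) * Z := by
    intro S D Z h
    rw [one_div, eq_inv_mul_iff_mul_eq₀ hN]
    linear_combination h + 2 * D * hκ
  exact hmono.trans (le_of_eq (congrArg (· + _) (aux _ _ _ hsd)))

end Overlap

/-! ### The fluctuation of the reduced vector and its mean. -/

section Fluctuation

variable {n : ℕ} {γ : Fin (n + 1) → ℝ} {γt θ : ℝ}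

/-- The fluctuation of the reduced vector `y ∈ ℝⁿ`: the deviation of its Rayleigh quotient from `v`
and of `‖y‖²` from `n + 1`, on the scale of the error terms. -/
noncomputable def fluctuation (γ : Fin n → ℝ) (v : ℝ) (y : Fin n → ℝ) : ℝ :=
  |rayleigh γ y - v| + |normSq y / (n + 1) - 1| + 1 / (n + 1)

@[fun_prop]
lemma measurable_fluctuation (γ : Fin n → ℝ) (v : ℝ) : Measurable (fluctuation γ v) := by
  unfold fluctuation
  have h₁ : Measurable fun y => |rayleigh γ y - v| := by fun_prop
  have h₂ : Measurable fun y : Fin n → ℝ => |normSq y / (n + 1) - 1| := by fun_prop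
  exact (h₁.add h₂).add_const _

lemma inv_le_fluctuation (γ : Fin n → ℝ) (v : ℝ) (y : Fin n → ℝ) :
    1 / (n + 1) ≤ fluctuation γ v y := by
  unfold fluctuation
  linarith [abs_nonneg (rayleigh γ y - v), abs_nonneg (normSq y / (n + 1) - 1)]

lemma fluctuation_pos (γ : Fin n → ℝ) (v : ℝ) (y : Fin n → ℝ) : 0 < fluctuation γ v y :=
  lt_of_lt_of_le (by positivity) (inv_le_fluctuation γ v y)

/-- Passing from the reduced to the full vector costs `γt` times the overlap in the energy and `g d
^ 2 / (n + 1)` in the radius; the means of both are controlled by the mean overlap. -/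
lemma fluctuation_le (h0 : 0 ≤ γt) (hγ : ∀ j, γ j ∈ Set.Icc 0 γt) (d : Fin (n + 1)) (v : ℝ)
    (p : ℝ × (Fin n → ℝ)) :
    fluctuation (fun j => γ (d.succAbove j)) v p.2 ≤
      |rayleigh γ (insertCoord d p) - v| +
      γt * (insertCoord d p d ^ 2 / normSq (insertCoord d p)) +
      |normSq (insertCoord d p) / (n + 1) - 1| + insertCoord d p d ^ 2 / (n + 1) + 1 / (n + 1) := by
  have hN : (0 : ℝ) < n + 1 := by positivity
  have h1 := rayleigh_insertCoord γ d p
  set h := rayleigh γ (insertCoord d p)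
  set a := rayleigh (fun j => γ (d.succAbove j)) p.2 with ha
  rw [normSq_insertCoord, insertCoord_same]
  have ha0 : 0 ≤ a := rayleigh_nonneg (fun j => (hγ _).1) _
  have ha1 : a ≤ γt := rayleigh_le h0 (fun j => (hγ _).2) _
  have hd := hγ d
  have hs : 0 ≤ p.1 ^ 2 / (p.1 ^ 2 + normSq p.2) :=
    div_nonneg (sq_nonneg _) (add_nonneg (sq_nonneg _) (normSq_nonneg _))
  have e1 : |a - v| ≤ |h - v| + γt * (p.1 ^ 2 / (p.1 ^ 2 + normSq p.2)) := by
    have : a - v = (h - v) + p.1 ^ 2 / (p.1 ^ 2 + normSq p.2) * (a - γ d) := by rw [h1]; ring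
    rw [this]
    refine (abs_add_le _ _).trans (add_le_add_right ?_ _)
    rw [abs_mul, abs_of_nonneg hs, mul_comm]
    refine mul_le_mul_of_nonneg_right ?_ hs
    rw [abs_le]
    constructor <;> linarith [hd.1, hd.2]
  have e2 : |normSq p.2 / (n + 1) - 1| ≤
      |(p.1 ^ 2 + normSq p.2) / (n + 1) - 1| + p.1 ^ 2 / (n + 1) := by
    have : normSq p.2 / (n + 1) - 1 =
        ((p.1 ^ 2 + normSq p.2) / (n + 1) - 1) - p.1 ^ 2 / (n + 1) := by ring
    rw [this]
    refine (abs_sub _ _).trans (le_of_eq ?_)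
    rw [abs_of_nonneg (div_nonneg (sq_nonneg p.1) hN.le)]
  unfold fluctuation
  linarith

/-- The mean fluctuation under the Gibbs measure of `H_N`. -/
lemma integral_fluctuation_le (hn : 0 < n) (h0 : 0 ≤ γt) (hγ : ∀ j, γ j ∈ Set.Icc 0 γt)
    (d : Fin (n + 1)) {v c : ℝ} (hc0 : 0 < c) (hc : c ≤ 1 + 2 * θ * (v - γ d)) {κ : ℝ}
    (hκ : κ = θ * (n + 1)) :
    Integrable (fun p => fluctuation (fun j => γ (d.succAbove j)) v p.2 *
      Real.exp (κ * rayleigh γ (insertCoord d p))) ((gaussianReal 0 1).prod (stdNormal n)) ∧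
    ∫ p, fluctuation (fun j => γ (d.succAbove j)) v p.2 *
        Real.exp (κ * rayleigh γ (insertCoord d p)) ∂(gaussianReal 0 1).prod (stdNormal n) ≤
      (3 + (γt + 1) * (1 + 2 * |θ|) / c) *
        (∫ g, Real.exp (κ * rayleigh γ g) ∂stdNormal (n + 1)) *
        (1 / √(n + 1) + √((∫ g, Real.exp (κ * rayleigh γ g) ∂stdNormal (n + 1))⁻¹ *
          ∫ g, (rayleigh γ g - v) ^ 2 * Real.exp (κ * rayleigh γ g) ∂stdNormal (n + 1))) := by
  set W : (Fin (n + 1) → ℝ) → ℝ := fun g => Real.exp (κ * rayleigh γ g) with hW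
  have hWpos : ∀ g, 0 < W g := fun g => Real.exp_pos _
  have i0 : Integrable W (stdNormal (n + 1)) := integrable_exp_rayleigh h0 hγ κ
  have iS : Integrable (fun g => g d ^ 2 / normSq g * W g) (stdNormal (n + 1)) :=
    integrable_bdd_mul_exp_rayleigh (C := 1) h0 hγ κ (by fun_prop) fun g => by
      rw [abs_of_nonneg (sq_div_normSq_nonneg _ _)]
      exact sq_div_normSq_le_one _ _
  have iA : Integrable (fun g => |rayleigh γ g - v| * W g) (stdNormal (n + 1)) :=
    integrable_bdd_mul_exp_rayleigh (C := γt + |v|) h0 hγ κ (by fun_prop) fun g => by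
      rw [abs_abs]
      exact abs_rayleigh_sub_le h0 hγ _ _
  have iA2 : Integrable (fun g => (rayleigh γ g - v) ^ 2 * W g) (stdNormal (n + 1)) :=
    integrable_bdd_mul_exp_rayleigh (C := (γt + |v|) ^ 2) h0 hγ κ (by fun_prop) fun g => by
      rw [abs_pow]
      exact pow_le_pow_left₀ (abs_nonneg _) (abs_rayleigh_sub_le h0 hγ _ _) 2
  obtain ⟨iX, eX⟩ := integral_overlap_moments h0 hγ κ d
  obtain ⟨iR2, eR2⟩ := integral_normSq_div_sub_one_sq (Nat.succ_pos n) h0 hγ κ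
  push_cast at iR2 eR2
  have hZ : 0 < ∫ g, W g ∂stdNormal (n + 1) := integral_exp_pos i0
  have iR : Integrable (fun g => |normSq g / (n + 1) - 1| * W g) (stdNormal (n + 1)) := by
    refine (iR2.add i0).mono' (Measurable.aestronglyMeasurable ?_) (ae_of_all _ fun g => ?_)
    · have h₂ : Measurable fun y : Fin (n + 1) → ℝ => |normSq y / (n + 1) - 1| := by fun_prop
      exact h₂.mul (by fun_prop)
    · rw [Real.norm_of_nonneg (mul_nonneg (abs_nonneg _) (hWpos g).le), Pi.add_apply]
      have h₁ := sq_abs (normSq g / (n + 1) - 1)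
      have h₂ : |normSq g / (n + 1) - 1| ≤ (normSq g / (n + 1) - 1) ^ 2 + 1 := by
        nlinarith [sq_nonneg (|normSq g / (n + 1) - 1| - 1), abs_nonneg (normSq g / (n + 1) - 1)]
      calc _ ≤ ((normSq g / (n + 1) - 1) ^ 2 + 1) * W g :=
            mul_le_mul_of_nonneg_right h₂ (hWpos g).le
        _ = _ := by ring
  have bA := integral_abs_mul_le_sqrt (fun g => (hWpos g).le) i0 iA iA2 hZ
  have bR := integral_abs_mul_le_sqrt (fun g => (hWpos g).le) i0 iR iR2 hZ
  have bS := integral_overlap_le hn h0 hγ d hc hκ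
  rw [eR2] at bR
  set Z := ∫ g, W g ∂stdNormal (n + 1)
  set S := ∫ g, g d ^ 2 / normSq g * W g ∂stdNormal (n + 1)
  set a := Z⁻¹ * ∫ g, (rayleigh γ g - v) ^ 2 * W g ∂stdNormal (n + 1)
  set B := ∫ g, |rayleigh γ g - v| * W g ∂stdNormal (n + 1)
  have iT : Integrable (fun g => |rayleigh γ g - v| * W g + γt * (g d ^ 2 / normSq g * W g) +
      |normSq g / (n + 1) - 1| * W g + 1 / (n + 1) * (g d ^ 2 * W g) + 1 / (n + 1) * W g)
      (stdNormal (n + 1)) :=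
    (((iA.fun_add (iS.const_mul _)).fun_add iR).fun_add (iX.const_mul _)).fun_add (i0.const_mul _)
  have hpt : ∀ p : ℝ × (Fin n → ℝ),
      fluctuation (fun j => γ (d.succAbove j)) v p.2 * W (insertCoord d p) ≤
        (fun g => |rayleigh γ g - v| * W g + γt * (g d ^ 2 / normSq g * W g) +
          |normSq g / (n + 1) - 1| * W g + 1 / (n + 1) * (g d ^ 2 * W g) + 1 / (n + 1) * W g)
          (insertCoord d p) := fun p => by
    refine (mul_le_mul_of_nonneg_right (fluctuation_le h0 hγ d v p) (hWpos _).le).trans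
      (le_of_eq ?_)
    ring
  have iT' := (integrable_stdNormal_succ_iff d).1 iT
  have hmeas : Measurable (fun p : ℝ × (Fin n → ℝ) =>
      fluctuation (fun j => γ (d.succAbove j)) v p.2 * W (insertCoord d p)) := by
    have := measurable_insertCoord d
    fun_prop
  have iY : Integrable (fun p : ℝ × (Fin n → ℝ) =>
      fluctuation (fun j => γ (d.succAbove j)) v p.2 * W (insertCoord d p))
      ((gaussianReal 0 1).prod (stdNormal n)) := by
    refine iT'.mono' hmeas.aestronglyMeasurable (ae_of_all _ fun p => ?_)
    rw [Real.norm_of_nonneg (mul_nonneg (fluctuation_pos _ _ _).le (hWpos _).le)]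
    exact hpt p
  refine ⟨iY, (integral_mono iY iT' hpt).trans ?_⟩
  rw [← integral_stdNormal_succ d (fun g => |rayleigh γ g - v| * W g +
    γt * (g d ^ 2 / normSq g * W g) + |normSq g / (n + 1) - 1| * W g +
    1 / (n + 1) * (g d ^ 2 * W g) + 1 / (n + 1) * W g),
    integral_add (((iA.fun_add (iS.const_mul _)).fun_add iR).fun_add (iX.const_mul _))
      (i0.const_mul _),
    integral_add ((iA.fun_add (iS.const_mul _)).fun_add iR) (iX.const_mul _),
    integral_add (iA.fun_add (iS.const_mul _)) iR, integral_add iA (iS.const_mul _),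
    integral_const_mul, integral_const_mul, integral_const_mul, eX]
  have hN : (0 : ℝ) < n + 1 := by positivity
  have hN1 : (1 : ℝ) ≤ n + 1 := by linarith [Nat.cast_nonneg (α := ℝ) n]
  set q := 1 / √((n : ℝ) + 1) with hq
  have hq0 : 0 ≤ q := by positivity
  have hq1 : 1 / ((n : ℝ) + 1) ≤ q := by
    refine one_div_le_one_div_of_le (by positivity) ?_
    exact Real.sqrt_le_iff.2 ⟨hN.le, by nlinarith⟩
  have ha : 0 ≤ √a := Real.sqrt_nonneg _
  -- The relative variance `2 / (n + 1)` has square root `√2 q`, rounded up to `2 q`.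
  have bR' : ∫ g, |normSq g / (n + 1) - 1| * W g ∂stdNormal (n + 1) ≤ Z * (2 * q) := by
    refine bR.trans (mul_le_mul_of_nonneg_left ?_ hZ.le)
    refine Real.sqrt_le_iff.2 ⟨by positivity, ?_⟩
    rw [hq, mul_pow, div_pow, Real.sq_sqrt hN.le]
    field_simp
    norm_num
  have bS' : S ≤ Z * ((1 + 2 * |θ|) / c * (q + √a)) := by
    have h1 : c * S ≤ q * Z + 2 * |θ| * (Z * √a) :=
      bS.trans (add_le_add (mul_le_mul_of_nonneg_right hq1 hZ.le)
        (mul_le_mul_of_nonneg_left bA (by positivity)))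
    have h2 : q * Z + 2 * |θ| * (Z * √a) ≤ Z * ((1 + 2 * |θ|) * (q + √a)) := by
      have : 0 ≤ Z * (√a + 2 * |θ| * q) := by positivity
      nlinarith
    have h3 : S ≤ Z * ((1 + 2 * |θ|) * (q + √a)) / c := by
      rw [le_div_iff₀ hc0]; linarith
    refine h3.trans (le_of_eq ?_)
    ring
  have hX : 1 / ((n : ℝ) + 1) * ((n + 1) * S) = S := by field_simp
  have h1 : 1 / ((n : ℝ) + 1) * Z ≤ Z * q := by
    rw [mul_comm]; exact mul_le_mul_of_nonneg_left hq1 hZ.le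
  have hX' : 1 / ((n : ℝ) + 1) * ((n + 1) *
      ∫ g, g d ^ 2 / normSq g * Real.exp (κ * rayleigh γ g) ∂stdNormal (n + 1)) = S := hX
  rw [hX']
  have h4 : (γt + 1) * S ≤ (γt + 1) * (Z * ((1 + 2 * |θ|) / c * (q + √a))) :=
    mul_le_mul_of_nonneg_left bS' (by linarith)
  have h5 : 0 ≤ Z * √a := by positivity
  calc _ ≤ Z * √a + (γt + 1) * S + Z * (2 * q) + Z * q := by linarith
    _ ≤ Z * √a + (γt + 1) * (Z * ((1 + 2 * |θ|) / c * (q + √a))) + Z * (2 * q) + Z * q := by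
        linarith
    _ ≤ (3 + (γt + 1) * (1 + 2 * |θ|) / c) * Z * (q + √a) := by
        have : (3 + (γt + 1) * (1 + 2 * |θ|) / c) * Z * (q + √a) =
          (γt + 1) * (Z * ((1 + 2 * |θ|) / c * (q + √a))) + 3 * (Z * q) + 3 * (Z * √a) := by ring
        linarith

end Fluctuation

/-! ### Pointwise comparison of the one-coordinate factors. -/

section Kernel

lemma abs_exp_sub_exp_le {A B m : ℝ} (hA : A ≤ m) (hB : B ≤ m) :
    |Real.exp A - Real.exp B| ≤ |A - B| * Real.exp m := by
  have key : ∀ {A B : ℝ}, A ≤ B → B ≤ m →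
      |Real.exp A - Real.exp B| ≤ |A - B| * Real.exp m := by
    intro A B hAB hB
    rw [abs_of_nonpos (sub_nonpos.2 (Real.exp_le_exp.2 hAB)), abs_of_nonpos (sub_nonpos.2 hAB)]
    have h1 : Real.exp A = Real.exp B * Real.exp (A - B) := by rw [← Real.exp_add]; ring_nf
    have h2 := Real.add_one_le_exp (A - B)
    have h3 : -(Real.exp A - Real.exp B) ≤ -(A - B) * Real.exp B := by
      rw [h1]; nlinarith [Real.exp_pos B]
    exact h3.trans (mul_le_mul_of_nonneg_left (Real.exp_le_exp.2 hB) (by linarith))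
  rcases le_total A B with h | h
  · exact key h hB
  · rw [abs_sub_comm, abs_sub_comm A]
    exact key h hA

/-- Bound both factors by `16 / c * exp (c / 16 * x ^ 2)`. The polynomial prefactor thus costs only
`c / 8` in the Gaussian exponent. -/
lemma sq_mul_one_add_sq_le {c : ℝ} (hc : 0 < c) (hc1 : c ≤ 1) (x : ℝ) :
    x ^ 2 * (1 + x ^ 2) ≤ (16 / c) ^ 2 * Real.exp (c / 8 * x ^ 2) := by
  have h1 := Real.add_one_le_exp (c / 16 * x ^ 2)
  have e : Real.exp (c / 8 * x ^ 2) = Real.exp (c / 16 * x ^ 2) ^ 2 := by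
    rw [← Real.exp_nat_mul]; congr 1; push_cast; ring
  have h2 : 1 + x ^ 2 ≤ 16 / c * Real.exp (c / 16 * x ^ 2) := by
    have h16 : 1 ≤ 16 / c := by rw [le_div_iff₀ hc]; linarith
    calc 1 + x ^ 2 ≤ 16 / c * (c / 16 * x ^ 2 + 1) := by
          have : 16 / c * (c / 16 * x ^ 2 + 1) = x ^ 2 + 16 / c := by field_simp
          linarith
      _ ≤ _ := mul_le_mul_of_nonneg_left h1 (by positivity)
  rw [e, ← mul_pow]
  have hx := sq_nonneg x
  nlinarith

/-- Comparison of the coupled and decoupled one-coordinate Boltzmann factors. -/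
lemma abs_kernel_sub_le {θ c γt v η h R N Y x : ℝ} (hc : 0 < c) (hc1 : c ≤ 1)
    (hcv : c ≤ 1 + 2 * θ * (v - η)) (hη : η ∈ Set.Icc 0 γt) (hN : 0 < N)
    (hh : |h - v| ≤ Y) (hR : |R / N - 1| ≤ Y) (hNY : 1 / N ≤ Y)
    (hY : Y ≤ c / 4) (hYθ : 8 * |θ| * Y ≤ c) :
    |Real.exp (-(θ * N * (x ^ 2 / (x ^ 2 + R) * (h - η)))) -
        Real.exp (-(θ * (v - η) * x ^ 2))| ≤
      2 * |θ| * (1 + (γt + |v|)) * (16 / c) ^ 2 * Y *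
        Real.exp (-(-(1 - c / 4) / 2 * x ^ 2)) := by
  have hY0 : 0 < Y := lt_of_lt_of_le (by positivity) hNY
  have hRN : 1 - Y ≤ R / N := by linarith [(abs_le.1 hR).1]
  have hR1 : (1 - c / 4) * N ≤ R := by
    rw [le_div_iff₀ hN] at hRN
    nlinarith
  have hRpos : 0 < R := lt_of_lt_of_le (by nlinarith) hR1
  set τ := N / (x ^ 2 + R) with hτ
  have hx := sq_nonneg x
  have hxR : 0 < x ^ 2 + R := by positivity
  have hτ0 : 0 < τ := by positivity
  have hτ1 : τ * (1 - c / 4) ≤ 1 := by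
    rw [hτ, div_mul_eq_mul_div, div_le_one hxR]
    linarith
  have hτ2 : τ ≤ 2 := by nlinarith
  have eA : -(θ * N * (x ^ 2 / (x ^ 2 + R) * (h - η))) = -(θ * (h - η) * τ) * x ^ 2 := by
    rw [hτ]; field_simp
  rw [eA]
  have hθh : |θ * (h - v)| ≤ c / 8 := by
    rw [abs_mul]
    nlinarith [abs_nonneg θ]
  have hA0 : -(2 * θ * (h - η)) ≤ 1 - 3 * c / 4 := by
    have := (abs_le.1 hθh).1
    nlinarith
  -- Replacing `v` by `h` costs `c / 4` of the margin `c`, and `τ ≤ 1 / (1 - c / 4)`; since `1 -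
  -- 3c/4 ≤ (1 - c/2)(1 - c/4)`, a margin `c / 2` survives. The polynomial prefactor uses half of
  -- that, leaving the envelope exponent `(1 - c / 4) / 2 < 1 / 2`.
  have hA1 : -(2 * θ * (h - η)) * τ ≤ 1 - c / 2 := by
    calc -(2 * θ * (h - η)) * τ ≤ (1 - 3 * c / 4) * τ := mul_le_mul_of_nonneg_right hA0 hτ0.le
      _ ≤ (1 - c / 2) * (τ * (1 - c / 4)) := by nlinarith [mul_pos hτ0 (mul_pos hc hc)]
      _ ≤ (1 - c / 2) * 1 := mul_le_mul_of_nonneg_left hτ1 (by linarith)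
      _ = _ := mul_one _
  have hA : -(θ * (h - η) * τ) * x ^ 2 ≤ (1 - c / 2) / 2 * x ^ 2 :=
    mul_le_mul_of_nonneg_right (by linarith) hx
  have hB : -(θ * (v - η) * x ^ 2) ≤ (1 - c / 2) / 2 * x ^ 2 := by
    rw [← neg_mul]
    exact mul_le_mul_of_nonneg_right (by linarith) hx
  have hτY : |τ - 1| ≤ 2 * Y * (1 + x ^ 2) := by
    have e : τ - 1 = -(τ * ((R / N - 1) + x ^ 2 * (1 / N))) := by
      rw [hτ]; field_simp; ring
    rw [e, abs_neg, abs_mul, abs_of_pos hτ0]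
    have h1 : |R / N - 1 + x ^ 2 * (1 / N)| ≤ Y + x ^ 2 * Y := by
      refine (abs_add_le _ _).trans (add_le_add hR ?_)
      rw [abs_of_nonneg (by positivity)]
      exact mul_le_mul_of_nonneg_left hNY hx
    calc τ * |R / N - 1 + x ^ 2 * (1 / N)| ≤ 2 * (Y + x ^ 2 * Y) :=
          mul_le_mul hτ2 h1 (abs_nonneg _) (by norm_num)
      _ = _ := by ring
  have hD : |v - η| ≤ γt + |v| := by
    refine (abs_sub _ _).trans ?_
    rw [abs_of_nonneg hη.1]
    linarith [hη.2]
  have hAB : |-(θ * (h - η) * τ) * x ^ 2 - -(θ * (v - η) * x ^ 2)| ≤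
      2 * |θ| * (1 + (γt + |v|)) * Y * (x ^ 2 * (1 + x ^ 2)) := by
    have e : -(θ * (h - η) * τ) * x ^ 2 - -(θ * (v - η) * x ^ 2) =
        -(θ * x ^ 2 * (τ * (h - v) + (v - η) * (τ - 1))) := by ring
    rw [e, abs_neg, abs_mul, abs_mul, abs_of_nonneg hx]
    have h1 : |τ * (h - v) + (v - η) * (τ - 1)| ≤
        2 * Y * (1 + x ^ 2) + (γt + |v|) * (2 * Y * (1 + x ^ 2)) := by
      refine (abs_add_le _ _).trans (add_le_add ?_ ?_)
      · rw [abs_mul, abs_of_pos hτ0]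
        calc τ * |h - v| ≤ 2 * Y := mul_le_mul hτ2 hh (abs_nonneg _) (by norm_num)
          _ ≤ _ := by nlinarith
      · rw [abs_mul]
        exact mul_le_mul hD hτY (abs_nonneg _) ((abs_nonneg _).trans hD)
    calc |θ| * x ^ 2 * |τ * (h - v) + (v - η) * (τ - 1)|
        ≤ |θ| * x ^ 2 * (2 * Y * (1 + x ^ 2) + (γt + |v|) * (2 * Y * (1 + x ^ 2))) :=
          mul_le_mul_of_nonneg_left h1 (by positivity)
      _ = _ := by ring
  have hγv : 0 ≤ γt + |v| := (abs_nonneg _).trans hD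
  refine (abs_exp_sub_exp_le hA hB).trans ?_
  calc _ ≤ 2 * |θ| * (1 + (γt + |v|)) * Y * ((16 / c) ^ 2 * Real.exp (c / 8 * x ^ 2)) *
        Real.exp ((1 - c / 2) / 2 * x ^ 2) := by
        refine mul_le_mul_of_nonneg_right (hAB.trans ?_) (Real.exp_pos _).le
        exact mul_le_mul_of_nonneg_left (sq_mul_one_add_sq_le hc hc1 x) (by positivity)
    _ = 2 * |θ| * (1 + (γt + |v|)) * (16 / c) ^ 2 * Y *
        (Real.exp (c / 8 * x ^ 2) * Real.exp ((1 - c / 2) / 2 * x ^ 2)) := by ring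
    _ = _ := by
        rw [← Real.exp_add]
        congr 2
        ring

end Kernel

/-! ### Pointwise comparison of the two Boltzmann weights. -/

section Comparison

variable {n : ℕ} {γ : Fin (n + 1) → ℝ} {γt θ : ℝ}

/-- The constant in the `L¹` comparison of the coupled and decoupled Boltzmann weights. -/
noncomputable def comparisonConst (γt θ v c : ℝ) : ℝ :=
  (2 * |θ| * (1 + (γt + |v|)) * (16 / c) ^ 2 + (4 / c + 8 * |θ| / c) + 72) *
    (√(c / 4))⁻¹ * √(1 + 4 * |θ| * γt) + (4 / c + 8 * |θ| / c)

/-- For small fluctuation the kernel estimate gives the first term. Otherwise the weights are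
bounded one by one: the coupled one by the second term, the decoupled one by the first if `normSq`
is at least `(n + 1) / 2` and by the third if not. -/
lemma abs_weight_sub_le (hn : 3 ≤ n) (hγ : ∀ j, γ j ∈ Set.Icc 0 γt)
    (d : Fin (n + 1)) {v c : ℝ} (hc0 : 0 < c) (hc1 : c ≤ 1)
    (hc : c ≤ 1 + 2 * θ * (v - γ d)) {κ : ℝ} (hκ : κ = θ * (n + 1)) (p : ℝ × (Fin n → ℝ)) :
    |Real.exp (κ * rayleigh γ (insertCoord d p)) -
      Real.exp (κ * rayleigh (fun j => γ (d.succAbove j)) p.2) *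
        Real.exp (-(θ * (v - γ d) * p.1 ^ 2))| ≤
    (2 * |θ| * (1 + (γt + |v|)) * (16 / c) ^ 2 + (4 / c + 8 * |θ| / c)) *
      (Real.exp (-(-(1 - c / 4) / 2 * p.1 ^ 2)) *
        {y | ((n : ℝ) + 1) / 2 ≤ normSq y}.indicator
          (fun y => fluctuation (fun j => γ (d.succAbove j)) v y *
            Real.exp (κ * rayleigh (fun j => γ (d.succAbove j)) y)) p.2) +
    (4 / c + 8 * |θ| / c) * (fluctuation (fun j => γ (d.succAbove j)) v p.2 *
      Real.exp (κ * rayleigh γ (insertCoord d p))) +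
    9 * (Real.exp (-(-(1 - c / 4) / 2 * p.1 ^ 2)) * ((normSq p.2 / n - 1) ^ 2 *
      Real.exp (κ * rayleigh (fun j => γ (d.succAbove j)) p.2))) := by
  obtain ⟨x, y⟩ := p
  simp only
  have hN : (0 : ℝ) < n + 1 := by positivity
  have hn' : (3 : ℝ) ≤ n := by exact_mod_cast hn
  set h := rayleigh (fun j => γ (d.succAbove j)) y with hh
  set Y := fluctuation (fun j => γ (d.succAbove j)) v y with hY
  set k₁ := Real.exp (-(-(1 - c / 4) / 2 * x ^ 2)) with hk₁
  set M := Real.exp (κ * h) with hM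
  set C₁ := 2 * |θ| * (1 + (γt + |v|)) * (16 / c) ^ 2 with hC₁
  set E := 4 / c + 8 * |θ| / c with hE
  set R := normSq y with hRdef
  have hR0 : 0 ≤ R := normSq_nonneg y
  have hγt : 0 ≤ γt := (hγ d).1.trans (hγ d).2
  have hC₁0 : 0 ≤ C₁ := by positivity
  have hE0 : 0 ≤ E := by positivity
  have hM0 : 0 < M := Real.exp_pos _
  have hk₁0 : 0 < k₁ := Real.exp_pos _
  have hY0 : 0 < Y := fluctuation_pos _ _ _
  have hW : Real.exp (κ * rayleigh γ (insertCoord d (x, y))) =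
      M * Real.exp (-(θ * (n + 1) * (x ^ 2 / (x ^ 2 + R) * (h - γ d)))) := by
    rw [rayleigh_insertCoord, hM, ← Real.exp_add, hκ]
    congr 1
    simp only [← hh, ← hRdef]
    ring
  have hW0 := Real.exp_pos (κ * rayleigh γ (insertCoord d (x, y)))
  have hk₀ : Real.exp (-(θ * (v - γ d) * x ^ 2)) ≤ k₁ := by
    refine Real.exp_le_exp.2 (neg_le_neg (mul_le_mul_of_nonneg_right ?_ (sq_nonneg x)))
    linarith
  have hnn : 0 ≤ k₁ * {y | ((n : ℝ) + 1) / 2 ≤ normSq y}.indicator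
      (fun y => fluctuation (fun j => γ (d.succAbove j)) v y *
        Real.exp (κ * rayleigh (fun j => γ (d.succAbove j)) y)) y :=
    mul_nonneg hk₁0.le (Set.indicator_nonneg (fun y _ =>
      mul_nonneg (fluctuation_pos _ _ _).le (Real.exp_pos _).le) _)
  have ha1 : |h - v| ≤ Y := by
    rw [hY, fluctuation]
    have : 0 < 1 / ((n : ℝ) + 1) := by positivity
    linarith [abs_nonneg (normSq y / ((n : ℝ) + 1) - 1)]
  have ha2 : |R / (n + 1) - 1| ≤ Y := by
    rw [hY, fluctuation]
    have : 0 < 1 / ((n : ℝ) + 1) := by positivity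
    linarith [abs_nonneg (rayleigh (fun j => γ (d.succAbove j)) y - v)]
  by_cases hsmall : Y ≤ c / 4 ∧ 8 * |θ| * Y ≤ c
  · have hmem : y ∈ {y : Fin n → ℝ | ((n : ℝ) + 1) / 2 ≤ normSq y} := by
      have h1 := (abs_le.1 ha2).1
      have h2 : 1 / 2 ≤ R / (n + 1) := by linarith [hsmall.1]
      rw [le_div_iff₀ hN] at h2
      simp only [Set.mem_ofPred_eq, ← hRdef]
      linarith
    rw [Set.indicator_of_mem hmem, hW, ← mul_sub, abs_mul, abs_of_pos hM0]
    have hker := abs_kernel_sub_le (x := x) hc0 hc1 hc (hγ d) hN ha1 ha2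
      (inv_le_fluctuation _ _ _) hsmall.1 hsmall.2
    rw [← hW]
    have t1 := mul_le_mul_of_nonneg_left hker hM0.le
    have t2 : 0 ≤ E * (k₁ * (Y * M)) := by positivity
    have t3 : 0 ≤ E * (Y * Real.exp (κ * rayleigh γ (insertCoord d (x, y)))) := by positivity
    have t4 : 0 ≤ 9 * (k₁ * ((R / n - 1) ^ 2 * M)) := by positivity
    calc _ ≤ M * (C₁ * Y * k₁) := t1
      _ = C₁ * (k₁ * (Y * M)) := by ring
      _ ≤ _ := by rw [add_mul]; linarith
  -- `E` is the sum of the reciprocals `4 / c` and `8|θ| / c` of the two smallness thresholds, so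
  -- violating either suffices.
  · have hEY : 1 ≤ E * Y := by
      have e : E * Y = (4 * Y + 8 * |θ| * Y) / c := by rw [hE]; ring
      rw [e, le_div_iff₀ hc0, one_mul]
      by_contra! hlt
      have : 0 ≤ 8 * |θ| * Y := by positivity
      exact hsmall ⟨by linarith, by linarith⟩
    refine (abs_sub _ _).trans ?_
    rw [abs_of_pos hW0, abs_of_pos (mul_pos hM0 (Real.exp_pos _))]
    have b1 : Real.exp (κ * rayleigh γ (insertCoord d (x, y))) ≤
        E * (Y * Real.exp (κ * rayleigh γ (insertCoord d (x, y)))) := by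
      rw [← mul_assoc]
      exact le_mul_of_one_le_left hW0.le hEY
    have b2 : M * Real.exp (-(θ * (v - γ d) * x ^ 2)) ≤ M * k₁ :=
      mul_le_mul_of_nonneg_left hk₀ hM0.le
    by_cases hmem : y ∈ {y : Fin n → ℝ | ((n : ℝ) + 1) / 2 ≤ normSq y}
    · rw [Set.indicator_of_mem hmem]
      have t1 : M * k₁ ≤ E * (k₁ * (Y * M)) := by
        calc M * k₁ ≤ E * Y * (M * k₁) := le_mul_of_one_le_left (by positivity) hEY
          _ = _ := by ring
      have t2 : 0 ≤ C₁ * (k₁ * (Y * M)) := by positivity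
      have t4 : 0 ≤ 9 * (k₁ * ((R / n - 1) ^ 2 * M)) := by positivity
      rw [add_mul]
      linarith
    · have h9 : 1 ≤ 9 * (R / n - 1) ^ 2 := by
        simp only [Set.mem_ofPred_eq, not_le, ← hRdef] at hmem
        -- `n ≥ 3` gives `(n + 1) / 2 ≤ 2n / 3`; the relative deviation is then at least `1 / 3`,
        -- whence the factor 9.
        have h1 : R / n ≤ 2 / 3 := by
          rw [div_le_iff₀ (by linarith)]
          linarith
        nlinarith
      have t1 : M * k₁ ≤ 9 * (k₁ * ((R / n - 1) ^ 2 * M)) := by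
        calc M * k₁ ≤ 9 * (R / n - 1) ^ 2 * (M * k₁) := le_mul_of_one_le_left (by positivity) h9
          _ = _ := by ring
      have t2 := mul_nonneg (add_nonneg hC₁0 hE0) hnn
      linarith

end Comparison

/-! ### Comparison of the weights in `L¹`. -/

section Comparison

variable {n : ℕ} {γ : Fin (n + 1) → ℝ} {γt θ : ℝ}

lemma integrable_fluctuation_mul_exp {γ : Fin n → ℝ} (h0 : 0 ≤ γt)
    (hγ : ∀ j, γ j ∈ Set.Icc 0 γt) (v κ : ℝ) :
    Integrable (fun y => fluctuation γ v y * Real.exp (κ * rayleigh γ y)) (stdNormal n) := by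
  obtain ⟨i1, -, -, -⟩ := integral_normSq_mul_of_homogeneous
    (L := fun y => Real.exp (κ * rayleigh γ y)) (C := Real.exp (|κ| * γt)) (by fun_prop)
    (fun y => (Real.exp_pos _).le) (exp_rayleigh_le h0 hγ κ)
    (fun t ht y => by rw [rayleigh_smul γ ht])
  have i0 := integrable_exp_rayleigh h0 hγ κ
  refine ((i0.const_mul (γt + |v| + 2)).add i1).mono' (by fun_prop) (ae_of_all _ fun y => ?_)
  have hY := fluctuation_pos γ v y
  have hM := Real.exp_pos (κ * rayleigh γ y)
  rw [Real.norm_of_nonneg (by positivity), Pi.add_apply, ← add_mul]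
  refine mul_le_mul_of_nonneg_right ?_ hM.le
  have hN : (1 : ℝ) ≤ n + 1 := by linarith [Nat.cast_nonneg (α := ℝ) n]
  have h1 := abs_rayleigh_sub_le h0 hγ v y
  have hq := normSq_nonneg y
  have h2 : |normSq y / (n + 1) - 1| ≤ normSq y + 1 := by
    refine (abs_sub _ _).trans ?_
    rw [abs_one, abs_of_nonneg (by positivity)]
    linarith [div_le_self hq hN]
  have h3 : 1 / ((n : ℝ) + 1) ≤ 1 := by
    rw [div_le_one (by linarith)]; exact hN
  unfold fluctuation
  linarith

/-- If `normSq` is at least `(n + 1) / 2`, then `n + 1` times the overlap is at most `2 x²`, so the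
exponent moves by at most `2|θ| γt x²`. Integrating out `x` dominates integrals over the reduced
vector by integrals under the coupled weight. -/
lemma indicator_mul_exp_le (hγ : ∀ j, γ j ∈ Set.Icc 0 γt)
    (d : Fin (n + 1)) (v : ℝ) {κ : ℝ} (hκ : κ = θ * (n + 1)) (p : ℝ × (Fin n → ℝ)) :
    Real.exp (-(2 * |θ| * γt * p.1 ^ 2)) *
        {y | ((n : ℝ) + 1) / 2 ≤ normSq y}.indicator
          (fun y => fluctuation (fun j => γ (d.succAbove j)) v y *
            Real.exp (κ * rayleigh (fun j => γ (d.succAbove j)) y)) p.2 ≤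
      fluctuation (fun j => γ (d.succAbove j)) v p.2 *
        Real.exp (κ * rayleigh γ (insertCoord d p)) := by
  have hY := fluctuation_pos (fun j => γ (d.succAbove j)) v p.2
  by_cases hmem : p.2 ∈ {y : Fin n → ℝ | ((n : ℝ) + 1) / 2 ≤ normSq y}
  · rw [Set.indicator_of_mem hmem, mul_left_comm, ← Real.exp_add]
    refine mul_le_mul_of_nonneg_left (Real.exp_le_exp.2 ?_) hY.le
    rw [rayleigh_insertCoord]
    simp only [Set.mem_ofPred_eq] at hmem
    set h := rayleigh (fun j => γ (d.succAbove j)) p.2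
    have hγt : 0 ≤ γt := (hγ d).1.trans (hγ d).2
    have hN : (0 : ℝ) < n + 1 := by positivity
    have h0 : 0 ≤ h := rayleigh_nonneg (fun j => (hγ _).1) _
    have h1 : h ≤ γt := rayleigh_le hγt (fun j => (hγ _).2) _
    have hd := hγ d
    have hx := sq_nonneg p.1
    have hpos : 0 < p.1 ^ 2 + normSq p.2 := by linarith
    have hτ : (n + 1) * (p.1 ^ 2 / (p.1 ^ 2 + normSq p.2)) ≤ 2 * p.1 ^ 2 := by
      rw [← mul_div_assoc, div_le_iff₀ hpos]
      nlinarith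
    have hτ0 : 0 ≤ (n + 1) * (p.1 ^ 2 / (p.1 ^ 2 + normSq p.2)) := by positivity
    have hhd : |h - γ d| ≤ γt := by
      rw [abs_le]; constructor <;> linarith [hd.1, hd.2]
    have key : θ * ((n + 1) * (p.1 ^ 2 / (p.1 ^ 2 + normSq p.2))) * (h - γ d) ≤
        2 * |θ| * γt * p.1 ^ 2 := by
      refine (le_abs_self _).trans ?_
      rw [abs_mul, abs_mul, abs_of_nonneg hτ0]
      calc _ ≤ |θ| * (2 * p.1 ^ 2) * γt :=
            mul_le_mul (mul_le_mul_of_nonneg_left hτ (abs_nonneg _)) hhd (abs_nonneg _)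
              (by positivity)
        _ = _ := by ring
    have e : κ * (h - p.1 ^ 2 / (p.1 ^ 2 + normSq p.2) * (h - γ d)) =
        κ * h - θ * ((n + 1) * (p.1 ^ 2 / (p.1 ^ 2 + normSq p.2))) * (h - γ d) := by
      rw [hκ]; ring
    rw [e]
    linarith
  · rw [Set.indicator_of_notMem hmem, mul_zero]
    positivity

/-- `L¹` comparison of the coupled and decoupled Boltzmann weights. -/
lemma integral_abs_weight_sub_le (hn : 36 ≤ n) (hγ : ∀ j, γ j ∈ Set.Icc 0 γt)
    (d : Fin (n + 1)) {v c : ℝ} (hc0 : 0 < c) (hc1 : c ≤ 1)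
    (hc : c ≤ 1 + 2 * θ * (v - γ d)) {κ : ℝ} (hκ : κ = θ * (n + 1)) :
    ∫ p, |Real.exp (κ * rayleigh γ (insertCoord d p)) -
      Real.exp (κ * rayleigh (fun j => γ (d.succAbove j)) p.2) *
        Real.exp (-(θ * (v - γ d) * p.1 ^ 2))| ∂(gaussianReal 0 1).prod (stdNormal n) ≤
    comparisonConst γt θ v c *
      ∫ p, fluctuation (fun j => γ (d.succAbove j)) v p.2 *
        Real.exp (κ * rayleigh γ (insertCoord d p)) ∂(gaussianReal 0 1).prod (stdNormal n) := by
  have hγt : 0 ≤ γt := (hγ d).1.trans (hγ d).2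
  have hγ' : ∀ j : Fin n, γ (d.succAbove j) ∈ Set.Icc 0 γt := fun j => hγ _
  have hn' : (36 : ℝ) ≤ n := by exact_mod_cast hn
  have hb₁ : 0 < 1 + 2 * (-(1 - c / 4) / 2) := by linarith
  have hb₂ : 0 < 1 + 2 * (2 * |θ| * γt) := by positivity
  have iY := (integral_fluctuation_le (by omega) hγt hγ d hc0 hc hκ).1
  have ik₁ := integrable_exp_neg_sq_gaussianReal hb₁
  have ik₂ := integrable_exp_neg_sq_gaussianReal hb₂
  have ek₁ := integral_exp_neg_sq_gaussianReal hb₁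
  have ek₂ := integral_exp_neg_sq_gaussianReal hb₂
  have hs : MeasurableSet {y : Fin n → ℝ | ((n : ℝ) + 1) / 2 ≤ normSq y} :=
    measurableSet_le measurable_const measurable_normSq
  have iJ := (integrable_fluctuation_mul_exp hγt hγ' v κ).indicator hs
  have iM := integrable_exp_rayleigh hγt hγ' κ
  obtain ⟨iQ, eQ⟩ := integral_normSq_div_sub_one_sq (n := n) (by omega) hγt hγ' κ
  have hJ := integral_mono (ik₂.mul_prod iJ) iY (indicator_mul_exp_le hγ d v hκ)
  have pJ : ∀ b : ℝ, ∫ p : ℝ × (Fin n → ℝ), Real.exp (-(b * p.1 ^ 2)) *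
      {y | ((n : ℝ) + 1) / 2 ≤ normSq y}.indicator
        (fun y => fluctuation (fun j => γ (d.succAbove j)) v y *
          Real.exp (κ * rayleigh (fun j => γ (d.succAbove j)) y)) p.2
        ∂(gaussianReal 0 1).prod (stdNormal n) = _ := fun b =>
    integral_prod_mul (fun x : ℝ => Real.exp (-(b * x ^ 2))) _
  have pQ : ∀ b : ℝ, ∫ p : ℝ × (Fin n → ℝ), Real.exp (-(b * p.1 ^ 2)) *
      ((normSq p.2 / n - 1) ^ 2 * Real.exp (κ * rayleigh (fun j => γ (d.succAbove j)) p.2))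
        ∂(gaussianReal 0 1).prod (stdNormal n) = _ := fun b =>
    integral_prod_mul (fun x : ℝ => Real.exp (-(b * x ^ 2))) (fun y => (normSq y / n - 1) ^ 2 *
      Real.exp (κ * rayleigh (fun j => γ (d.succAbove j)) y))
  rw [pJ, ek₂] at hJ
  -- On the large-radius set `(n + 1) Y ≥ 1`, which is what the summand `1 / (n + 1)` of
  -- `fluctuation` is for; off it the relative radial deviation is at least `1 / 3`.
  have hM : ∫ y, Real.exp (κ * rayleigh (fun j => γ (d.succAbove j)) y) ∂stdNormal n ≤
      ∫ y, ((n + 1) * {y | ((n : ℝ) + 1) / 2 ≤ normSq y}.indicator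
          (fun y => fluctuation (fun j => γ (d.succAbove j)) v y *
            Real.exp (κ * rayleigh (fun j => γ (d.succAbove j)) y)) y +
          9 * ((normSq y / n - 1) ^ 2 *
            Real.exp (κ * rayleigh (fun j => γ (d.succAbove j)) y))) ∂stdNormal n := by
    refine integral_mono iM ((iJ.const_mul _).fun_add (iQ.const_mul _)) fun y => ?_
    simp only
    have hM0 := Real.exp_pos (κ * rayleigh (fun j => γ (d.succAbove j)) y)
    by_cases hmem : y ∈ {y : Fin n → ℝ | ((n : ℝ) + 1) / 2 ≤ normSq y}
    · rw [Set.indicator_of_mem hmem]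
      have h1 := inv_le_fluctuation (fun j => γ (d.succAbove j)) v y
      rw [div_le_iff₀' (by positivity)] at h1
      have h2 := mul_le_mul_of_nonneg_right h1 hM0.le
      have h3 : 0 ≤ 9 * ((normSq y / n - 1) ^ 2 *
        Real.exp (κ * rayleigh (fun j => γ (d.succAbove j)) y)) := by positivity
      linarith
    · rw [Set.indicator_of_notMem hmem, mul_zero, zero_add, ← mul_assoc]
      refine le_mul_of_one_le_left hM0.le ?_
      simp only [Set.mem_ofPred_eq, not_le] at hmem
      have h1 : normSq y / n ≤ 2 / 3 := by
        rw [div_le_iff₀ (by linarith)]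
        linarith
      nlinarith
  rw [integral_add (iJ.const_mul _) (iQ.const_mul _), integral_const_mul, integral_const_mul,
    eQ] at hM
  have hpt := abs_weight_sub_le (v := v) (by omega : 3 ≤ n) hγ d hc0 hc1 hc hκ
  have i1 := ((ik₁.mul_prod iJ).const_mul
    (2 * |θ| * (1 + (γt + |v|)) * (16 / c) ^ 2 + (4 / c + 8 * |θ| / c)))
  have i2 := iY.const_mul (4 / c + 8 * |θ| / c)
  have i3 := (ik₁.mul_prod iQ).const_mul 9
  have hL := integral_mono_of_nonneg (ae_of_all _ fun p => abs_nonneg _)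
    ((i1.fun_add i2).fun_add i3) (ae_of_all _ hpt)
  rw [integral_add (i1.fun_add i2) i3, integral_add i1 i2, integral_const_mul, integral_const_mul,
    integral_const_mul, pJ, pQ, eQ, ek₁] at hL
  refine hL.trans ?_
  set J := ∫ y, {y | ((n : ℝ) + 1) / 2 ≤ normSq y}.indicator
    (fun y => fluctuation (fun j => γ (d.succAbove j)) v y *
      Real.exp (κ * rayleigh (fun j => γ (d.succAbove j)) y)) y ∂stdNormal n
  set T := ∫ p, fluctuation (fun j => γ (d.succAbove j)) v p.2 *
    Real.exp (κ * rayleigh γ (insertCoord d p)) ∂(gaussianReal 0 1).prod (stdNormal n)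
  set I := ∫ y, Real.exp (κ * rayleigh (fun j => γ (d.succAbove j)) y) ∂stdNormal n
  have hI : 0 < I := integral_exp_pos iM
  have hJ' : J ≤ √(1 + 4 * |θ| * γt) * T := by
    have e : 1 + 2 * (2 * |θ| * γt) = 1 + 4 * |θ| * γt := by ring
    rw [e] at hJ hb₂
    rwa [inv_mul_le_iff₀ (Real.sqrt_pos.2 hb₂)] at hJ
  -- The radial error `18 / n * I` in the bound on `I` is at most `I / 2` exactly because `n ≥ 36`,
  -- and is absorbed on the left.
  have hnI : 2 / n * I ≤ 8 * J := by
    have h1 : 9 * (2 / n * I) ≤ I / 2 := by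
      have : 2 / (n : ℝ) ≤ 1 / 18 := by
        rw [div_le_div_iff₀ (by linarith) (by norm_num)]; linarith
      nlinarith
    have h2 : I ≤ 2 * ((n + 1) * J) := by linarith
    have hJ0 : 0 ≤ J := by
      by_contra! hneg
      nlinarith
    calc 2 / n * I ≤ 2 / n * (2 * ((n + 1) * J)) :=
          mul_le_mul_of_nonneg_left h2 (by positivity)
      _ = 4 * ((n + 1) / n) * J := by ring
      _ ≤ 4 * 2 * J := by
          refine mul_le_mul_of_nonneg_right (mul_le_mul_of_nonneg_left ?_ (by norm_num)) hJ0
          rw [div_le_iff₀ (by linarith)]; linarith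
      _ = 8 * J := by ring
  have e₁ : 1 + 2 * (-(1 - c / 4) / 2) = c / 4 := by ring
  rw [e₁]
  set C₃ := 2 * |θ| * (1 + (γt + |v|)) * (16 / c) ^ 2 + (4 / c + 8 * |θ| / c) with hC₃
  have hC₃0 : 0 ≤ C₃ := by positivity
  have hF : 0 ≤ (√(c / 4))⁻¹ := by positivity
  calc C₃ * ((√(c / 4))⁻¹ * J) + (4 / c + 8 * |θ| / c) * T + 9 * ((√(c / 4))⁻¹ * (2 / n * I))
      ≤ C₃ * ((√(c / 4))⁻¹ * J) + (4 / c + 8 * |θ| / c) * T + 9 * ((√(c / 4))⁻¹ * (8 * J)) := by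
        gcongr
    _ = (C₃ + 72) * (√(c / 4))⁻¹ * J + (4 / c + 8 * |θ| / c) * T := by ring
    _ ≤ (C₃ + 72) * (√(c / 4))⁻¹ * (√(1 + 4 * |θ| * γt) * T) + (4 / c + 8 * |θ| / c) * T := by
        gcongr
    _ = comparisonConst γt θ v c * T := by rw [comparisonConst, hC₃]; ring

end Comparison

/-! ### Comparison of normalized means. -/

section GibbsMean

variable {α : Type*} [MeasurableSpace α] {μ : Measure α} {w w' f : α → ℝ} {S : ℝ}

lemma abs_inv_mul_integral_le (hw : ∀ x, 0 ≤ w x) (iw : Integrable w μ)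
    (hZ : 0 < ∫ x, w x ∂μ) (hS : ∀ x, |f x| ≤ S) :
    |(∫ x, w x ∂μ)⁻¹ * ∫ x, f x * w x ∂μ| ≤ S := by
  rw [abs_mul, abs_of_pos (inv_pos.2 hZ), inv_mul_le_iff₀ hZ, mul_comm, ← integral_const_mul]
  refine norm_integral_le_of_norm_le (f := fun x => f x * w x) (iw.const_mul S)
    (ae_of_all _ fun x => ?_)
  rw [norm_mul, Real.norm_eq_abs, Real.norm_of_nonneg (hw x)]
  exact mul_le_mul_of_nonneg_right (hS x) (hw x)

/-- Two normalized weighted means differ by at most twice the normalized `L¹` distance of the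
weights. -/
lemma abs_weighted_mean_sub_le (hw' : ∀ x, 0 ≤ w' x)
    (iw : Integrable w μ) (iw' : Integrable w' μ) (hZ : 0 < ∫ x, w x ∂μ)
    (hZ' : 0 < ∫ x, w' x ∂μ) (hf : AEMeasurable f μ) (hS : ∀ x, |f x| ≤ S) :
    |(∫ x, w x ∂μ)⁻¹ * ∫ x, f x * w x ∂μ - (∫ x, w' x ∂μ)⁻¹ * ∫ x, f x * w' x ∂μ| ≤
      2 * S * ((∫ x, w x ∂μ)⁻¹ * ∫ x, |w x - w' x| ∂μ) := by
  have hmean := abs_inv_mul_integral_le hw' iw' hZ' hS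
  have ifw : Integrable (fun x => f x * w x) μ :=
    iw.bdd_mul hf.aestronglyMeasurable (ae_of_all _ hS)
  have ifw' : Integrable (fun x => f x * w' x) μ :=
    iw'.bdd_mul hf.aestronglyMeasurable (ae_of_all _ hS)
  have iD : Integrable (fun x => |w x - w' x|) μ := (iw.sub iw').abs
  have h1 : |∫ x, f x * w x ∂μ - ∫ x, f x * w' x ∂μ| ≤ S * ∫ x, |w x - w' x| ∂μ := by
    rw [← integral_sub ifw ifw', ← integral_const_mul]
    refine norm_integral_le_of_norm_le (f := fun x => f x * w x - f x * w' x) (iD.const_mul S)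
      (ae_of_all _ fun x => ?_)
    rw [← mul_sub, norm_mul, Real.norm_eq_abs, Real.norm_eq_abs]
    exact mul_le_mul_of_nonneg_right (hS x) (abs_nonneg _)
  have h2 : |∫ x, w x ∂μ - ∫ x, w' x ∂μ| ≤ ∫ x, |w x - w' x| ∂μ := by
    rw [← integral_sub iw iw']
    exact abs_integral_le_integral_abs
  set Z := ∫ x, w x ∂μ
  set Z' := ∫ x, w' x ∂μ
  set m := Z'⁻¹ * ∫ x, f x * w' x ∂μ with hm
  set D := ∫ x, |w x - w' x| ∂μ
  -- Normalizing by `Z` alone puts the change of normalization into `m * (Z - Z')`, so no lower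
  -- bound on `Z'` is needed.
  have e : Z⁻¹ * ∫ x, f x * w x ∂μ - m =
      Z⁻¹ * ((∫ x, f x * w x ∂μ - ∫ x, f x * w' x ∂μ) - m * (Z - Z')) := by
    rw [hm]
    field_simp
    ring
  rw [e, abs_mul, abs_of_pos (inv_pos.2 hZ)]
  have h3 : |m * (Z - Z')| ≤ S * D := by
    rw [abs_mul]
    exact mul_le_mul hmean h2 (abs_nonneg _) ((abs_nonneg _).trans hmean)
  calc _ ≤ Z⁻¹ * (S * D + S * D) :=
        mul_le_mul_of_nonneg_left ((abs_sub _ _).trans (add_le_add h1 h3)) (inv_pos.2 hZ).le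
    _ = _ := by ring

end GibbsMean

/-! ### Factorization of the decoupled measure and comparison of Gibbs means. -/

section Decoupling

variable {n : ℕ} {γ : Fin (n + 1) → ℝ} {γt θ v : ℝ}

lemma exp_mul_HN (γ : Fin (n + 1) → ℝ) (θ : ℝ) (g : Fin (n + 1) → ℝ) :
    Real.exp (θ * HN γ g) = Real.exp (θ * (n + 1) * rayleigh γ g) := by
  rw [HN_eq]
  push_cast
  rw [mul_assoc]

lemma exp_mul_Hd_insertCoord (γ : Fin (n + 1) → ℝ) (θ v : ℝ) (d : Fin (n + 1))
    (p : ℝ × (Fin n → ℝ)) :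
    Real.exp (θ * Hd γ v d (insertCoord d p)) =
      Real.exp (θ * (n + 1) * rayleigh (fun j => γ (d.succAbove j)) p.2) *
        Real.exp (-(θ * (v - γ d) * p.1 ^ 2)) := by
  rw [Hd_insertCoord, ← Real.exp_add]
  congr 1
  ring

lemma integrable_exp_mul_Hd_insertCoord (hγ : ∀ j, γ j ∈ Set.Icc 0 γt) (d : Fin (n + 1))
    (hpos : 0 < 1 + 2 * θ * (v - γ d)) :
    Integrable (fun p => Real.exp (θ * Hd γ v d (insertCoord d p)))
      ((gaussianReal 0 1).prod (stdNormal n)) := by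
  have hγt : 0 ≤ γt := (hγ d).1.trans (hγ d).2
  have i1 := integrable_exp_neg_sq_gaussianReal (b := θ * (v - γ d)) (by linarith)
  have i2 := integrable_exp_rayleigh (γ := fun j => γ (d.succAbove j)) hγt (fun j => hγ _)
    (θ * (n + 1))
  refine (i1.mul_prod i2).congr (ae_of_all _ fun p => ?_)
  simp only
  rw [exp_mul_Hd_insertCoord, mul_comm]

lemma integrable_exp_mul_Hd (hγ : ∀ j, γ j ∈ Set.Icc 0 γt) (d : Fin (n + 1))
    (hpos : 0 < 1 + 2 * θ * (v - γ d)) :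
    Integrable (fun g => Real.exp (θ * Hd γ v d g)) (stdNormal (n + 1)) :=
  (integrable_stdNormal_succ_iff d).2 (integrable_exp_mul_Hd_insertCoord hγ d hpos)

/-- Under the Gibbs measure of `H_d` the `d`-th coordinate is an independent Gaussian. -/
lemma gibbsMean_Hd_mul (d : Fin (n + 1))
    (hpos : 0 < 1 + 2 * θ * (v - γ d)) (φ : ℝ → ℝ) (ψ : ({i : Fin (n + 1) // i ≠ d} → ℝ) → ℝ) :
    gibbsMean θ (Hd γ v d) (fun g => φ (g d) * ψ (fun i => g i)) =
      (∫ x, φ x ∂gaussianReal 0 (Real.toNNReal (1 / (1 + 2 * θ * (v - γ d))))) *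
        gibbsMean θ (Hd γ v d) (fun g => ψ (fun i => g i)) := by
  have hb : 0 < 1 + 2 * (θ * (v - γ d)) := by linarith
  have hψ : ∀ p : ℝ × (Fin n → ℝ), ψ (fun i => insertCoord d p i) =
      ψ (fun i => insertCoord d (0, p.2) i) := by
    intro p
    congr 1 with ⟨i, hi⟩
    obtain ⟨j, rfl⟩ := Fin.exists_succAbove_eq hi
    simp
  have key : ∀ φ : ℝ → ℝ,
      ∫ g, φ (g d) * ψ (fun i => g i) * Real.exp (θ * Hd γ v d g) ∂stdNormal (n + 1) =
      (∫ x, φ x * Real.exp (-(θ * (v - γ d) * x ^ 2)) ∂gaussianReal 0 1) *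
        ∫ y, ψ (fun i => insertCoord d (0, y) i) *
          Real.exp (θ * (n + 1) * rayleigh (fun j => γ (d.succAbove j)) y) ∂stdNormal n := by
    intro φ
    rw [integral_stdNormal_succ d, ← integral_prod_mul]
    congr 1 with p
    rw [exp_mul_Hd_insertCoord, insertCoord_same, hψ]
    ring
  have h1 := key φ
  -- Both Gibbs means have the same normalization, so it is enough to compare numerators; the
  -- Gaussian factor `(√(1 + 2b))⁻¹` appears in both.
  have h2 := key (fun _ => 1)
  simp only [one_mul] at h2
  rw [integral_mul_exp_neg_sq_gaussianReal hb] at h1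
  rw [integral_exp_neg_sq_gaussianReal hb] at h2
  unfold gibbsMean
  rw [h1, h2, ← mul_assoc 2 θ]
  ring

lemma abs_gibbsMean_sub_le (hn : 36 ≤ n) (hγ : ∀ j, γ j ∈ Set.Icc 0 γt) (d : Fin (n + 1))
    {c : ℝ} (hc0 : 0 < c) (hc1 : c ≤ 1) (hc : c ≤ 1 + 2 * θ * (v - γ d))
    {f : (Fin (n + 1) → ℝ) → ℝ} (hf : AEMeasurable f (stdNormal (n + 1))) {S : ℝ}
    (hS : ∀ g, |f g| ≤ S) :
    |gibbsMean θ (HN γ) f - gibbsMean θ (Hd γ v d) f| ≤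
      2 * comparisonConst γt θ v c * (3 + (γt + 1) * (1 + 2 * |θ|) / c) * S *
        (1 / √(n + 1) + √(gibbsMean θ (HN γ) fun g => (hN γ g - v) ^ 2)) := by
  have hγt : 0 ≤ γt := (hγ d).1.trans (hγ d).2
  have hS0 : 0 ≤ S := (abs_nonneg _).trans (hS 0)
  have hK : 0 ≤ comparisonConst γt θ v c := by unfold comparisonConst; positivity
  have i1 := integrable_exp_rayleigh hγt hγ (θ * (n + 1))
  have i2 := integrable_exp_mul_Hd hγ d (hc0.trans_le hc)
  have hL := integral_abs_weight_sub_le hn hγ d hc0 hc1 hc rfl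
  have hT := (integral_fluctuation_le (by omega) hγt hγ d hc0 hc rfl).2
  have hmean := abs_weighted_mean_sub_le (fun g => (Real.exp_pos _).le) i1 i2 (integral_exp_pos i1)
    (integral_exp_pos i2) hf hS
  have hD : ∫ g, |Real.exp (θ * (n + 1) * rayleigh γ g) - Real.exp (θ * Hd γ v d g)|
      ∂stdNormal (n + 1) = ∫ p, |Real.exp (θ * (n + 1) * rayleigh γ (insertCoord d p)) -
      Real.exp (θ * (n + 1) * rayleigh (fun j => γ (d.succAbove j)) p.2) *
        Real.exp (-(θ * (v - γ d) * p.1 ^ 2))| ∂(gaussianReal 0 1).prod (stdNormal n) := by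
    rw [integral_stdNormal_succ d]
    simp_rw [exp_mul_Hd_insertCoord]
  have hZ := integral_exp_pos i1
  unfold gibbsMean
  simp_rw [exp_mul_HN, hN_eq]
  refine hmean.trans ?_
  rw [hD]
  have h1 := hL.trans (mul_le_mul_of_nonneg_left hT hK)
  set Z := ∫ g, Real.exp (θ * (n + 1) * rayleigh γ g) ∂stdNormal (n + 1)
  set q := 1 / √((n : ℝ) + 1) + √(Z⁻¹ * ∫ g, (rayleigh γ g - v) ^ 2 *
    Real.exp (θ * (n + 1) * rayleigh γ g) ∂stdNormal (n + 1))
  calc _ ≤ 2 * S * (Z⁻¹ * (comparisonConst γt θ v c *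
        ((3 + (γt + 1) * (1 + 2 * |θ|) / c) * Z * q))) := by gcongr
    _ = _ := by field_simp

/-- The trivial bound, for the finitely many dimensions that the asymptotic comparison leaves out.
-/
lemma abs_gibbsMean_sub_le_two_mul (hγ : ∀ j, γ j ∈ Set.Icc 0 γt) (d : Fin (n + 1))
    (hpos : 0 < 1 + 2 * θ * (v - γ d)) {f : (Fin (n + 1) → ℝ) → ℝ} {S : ℝ}
    (hS : ∀ g, |f g| ≤ S) :
    |gibbsMean θ (HN γ) f - gibbsMean θ (Hd γ v d) f| ≤ 2 * S := by
  have hγt : 0 ≤ γt := (hγ d).1.trans (hγ d).2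
  have i1 : Integrable (fun g => Real.exp (θ * HN γ g)) (stdNormal (n + 1)) := by
    simp_rw [exp_mul_HN]
    exact integrable_exp_rayleigh hγt hγ (θ * (n + 1))
  have i2 := integrable_exp_mul_Hd hγ d hpos
  have h1 := abs_inv_mul_integral_le (fun g => (Real.exp_pos _).le) i1 (integral_exp_pos i1) hS
  have h2 := abs_inv_mul_integral_le (fun g => (Real.exp_pos _).le) i2 (integral_exp_pos i2) hS
  refine (abs_sub _ _).trans ?_
  rw [two_mul]
  exact add_le_add h1 h2

end Decoupling

end SphericalModel

/-! ### The main theorem. -/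

theorem theorem1 (γt : ℝ) (hγt : 0 < γt) (γ : (N : ℕ) → Fin N → ℝ)
    (ρ : Measure ℝ) [IsProbabilityMeasure ρ] (hγ : EigenvalueHypothesis γt γ ρ)
    (θ : ℝ) (hθ : θ ∈ highTemp γt ρ) :
    (∃ K : ℝ, 0 < K ∧ ∀ (N : ℕ) (d : Fin N) (f : (Fin N → ℝ) → ℝ),
      AEMeasurable f (stdNormal N) → (∃ C : ℝ, ∀ g, |f g| ≤ C) →
        |gibbsMean θ (HN (γ N)) f - gibbsMean θ (Hd (γ N) (vlim γt ρ θ) d) f| ≤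
          K * (⨆ g, |f g|) * (1 / √(N : ℝ) + √(aN γt ρ (γ N) θ))) ∧
    (∀ (N : ℕ) (d : Fin N),
      0 < 1 + 2 * θ * (vlim γt ρ θ - γ N d) ∧
      Integrable (fun g => Real.exp (θ * Hd (γ N) (vlim γt ρ θ) d g)) (stdNormal N) ∧
      ∀ (φ : ℝ → ℝ) (ψ : ({i : Fin N // i ≠ d} → ℝ) → ℝ), Measurable φ → Measurable ψ →
        (∃ C : ℝ, ∀ x, |φ x| ≤ C) → (∃ C : ℝ, ∀ y, |ψ y| ≤ C) →
        gibbsMean θ (Hd (γ N) (vlim γt ρ θ) d) (fun g => φ (g d) * ψ (fun i => g i)) =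
          (∫ x, φ x ∂gaussianReal 0
            (Real.toNNReal (1 / (1 + 2 * θ * (vlim γt ρ θ - γ N d))))) *
          gibbsMean θ (Hd (γ N) (vlim γt ρ θ) d) (fun g => ψ (fun i => g i))) := by
  obtain ⟨c, hc0, hc1, hc⟩ := exists_precision_lower_bound hθ
  have hpos : ∀ (N : ℕ) (d : Fin N), 0 < 1 + 2 * θ * (vlim γt ρ θ - γ N d) := fun N d =>
    hc0.trans_le (hc _ (hγ.mem_Icc N d))
  refine ⟨?_, fun N d => ?_⟩
  · set v := vlim γt ρ θ with hv
    set K := 2 * comparisonConst γt θ v c * (3 + (γt + 1) * (1 + 2 * |θ|) / c) with hKdef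
    have hK0 : 0 ≤ K := by
      have : 0 ≤ comparisonConst γt θ v c := by unfold comparisonConst; positivity
      positivity
    -- The 14 serves `N ≤ 36`: there `1 / √N ≥ 1 / 7`, so the trivial bound `2 S = 14 * S * (1 / 7)`
    -- suffices.
    refine ⟨K + 14, by linarith, fun N d f hf ⟨C, hC⟩ => ?_⟩
    have hS : ∀ g, |f g| ≤ ⨆ g, |f g| := fun g => le_ciSup ⟨C, by rintro _ ⟨g, rfl⟩; exact hC g⟩ g
    set S := ⨆ g, |f g|
    have hS0 : 0 ≤ S := (abs_nonneg _).trans (hS 0)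
    rcases N with _ | n
    · exact d.elim0
    have ha := Real.sqrt_nonneg (aN γt ρ (γ (n + 1)) θ)
    by_cases hn : 36 ≤ n
    · refine (abs_gibbsMean_sub_le hn (hγ.mem_Icc (n + 1)) d hc0 hc1
        (hc _ (hγ.mem_Icc (n + 1) d)) hf hS).trans ?_
      push_cast
      exact mul_le_mul_of_nonneg_right (mul_le_mul_of_nonneg_right (by linarith) hS0)
        (by positivity)
    · refine (abs_gibbsMean_sub_le_two_mul (hγ.mem_Icc (n + 1)) d (hpos _ d) hS).trans ?_
      have hq : 1 / 7 ≤ 1 / √((n + 1 : ℕ) : ℝ) := by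
        refine one_div_le_one_div_of_le (by positivity) (Real.sqrt_le_iff.2 ⟨by norm_num, ?_⟩)
        have : ((n + 1 : ℕ) : ℝ) ≤ 36 := by exact_mod_cast (by omega : n + 1 ≤ 36)
        linarith
      calc 2 * S = 14 * S * (1 / 7) := by ring
        _ ≤ (K + 14) * S * (1 / √((n + 1 : ℕ) : ℝ) + √(aN γt ρ (γ (n + 1)) θ)) :=
          mul_le_mul (mul_le_mul_of_nonneg_right (by linarith) hS0) (by linarith) (by norm_num)
            (by positivity)
  · rcases N with _ | n
    · exact d.elim0
    exact ⟨hpos _ d, integrable_exp_mul_Hd (hγ.mem_Icc (n + 1)) d (hpos _ d),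
      fun φ ψ _ _ _ _ => gibbsMean_Hd_mul d (hpos _ d) φ ψ⟩
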